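/- For $N\ge 1$ let $G=G_N$ be an $N\times N$ GOE matrix, i.e. a random real symmetric matrix with density proportional to $e^{-\operatorname{Tr} G^2/2}$ (independent entries on and above the diagonal, $\mathrm N(0,1)$ on the diagonal and $\mathrm N(0,1/2)$, variance $1/2$, above it), all $G_N$ being defined on a common probability space with an arbitrary joint law. Put $\tilde G_N=\frac1{\sqrt{2N}}G_N$ and let $\hat{\mathbf 1}_N=\frac1{\sqrt N}(1,\dots,1)^T\in\mathbb R^N$. Let $\alpha\ge 0$. (a) Let $\hat{\mathbf v}_N$ be a unit eigenvector for the largest eigenvalue of $\tilde G_N+\alpha\,\hat{\mathbf 1}_N\hat{\mathbf 1}_N^T$. Then, almost surely (and for every choice of the vectors $\hat{\mathbf v}_N$), as $N\to\infty$, $$(\hat{\mathbf 1}_N\cdot\hat{\mathbf v}_N)^2\;\to\;\begin{cases}0,&0\le\alpha\le \tfrac12,\\ 1-\dfrac1{4\alpha^2},&\alpha>\tfrac12.\end{cases}$$ (b) Equivalently, in the normalisation where the limiting spectrum of the unperturbed matrix is $[-2,2]$: if $\hat{\mathbf v}_N$ is a unit eigenvector for the largest eigenvalue of $2\tilde G_N+\alpha\,\hat{\mathbf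 1}_N\hat{\mathbf 1}_N^T$, then, almost surely (and for every choice of the vectors $\hat{\mathbf v}_N$), as $N\to\infty$, $$(\hat{\mathbf 1}_N\cdot\hat{\mathbf v}_N)^2\;\to\;\begin{cases}0,&0\le\alpha\le 1,\\ 1-\dfrac1{\alpha^2},&\alpha>1.\end{cases}$$ -/

import Mathlib

open MeasureTheory ProbabilityTheory Filter Topology

noncomputable section

/-- `IsGOE P G`: under `P`, the random matrix `G` is distributed as the `N × N` Gaussian orthogonal
ensemble with probability density proportional to `exp (- Tr G² / 2)` on real symmetric matrices.
That is, `G` is symmetric, its entries on and above the diagonal are independent, the diagonal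
entries are centred Gaussians of variance `1`, and the entries above the diagonal are centred
Gaussians of variance `1 / 2`. -/
structure IsGOE {Ω : Type*} [MeasurableSpace Ω] (P : Measure Ω) {N : ℕ}
    (G : Ω → Matrix (Fin N) (Fin N) ℝ) : Prop where
  symm : ∀ᵐ ω ∂P, (G ω).IsSymm
  hasLaw_diag : ∀ i, HasLaw (fun ω => G ω i i) (gaussianReal 0 1) P
  hasLaw_upper : ∀ i j, i < j → HasLaw (fun ω => G ω i j) (gaussianReal 0 (1 / 2)) P
  indep : iIndepFun
    (fun (p : {p : Fin N × Fin N // p.1 ≤ p.2}) (ω : Ω) => G ω p.1.1 p.1.2) P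

/-- The scaling by `1 / √(2N)` of an `N × N` matrix. -/
def scaledMatrix {N : ℕ} (G : Matrix (Fin N) (Fin N) ℝ) : Matrix (Fin N) (Fin N) ℝ :=
  (1 / √(2 * (N : ℝ))) • G

/-- The unit vector in `ℝ^N` with all entries equal to `1 / √N`. -/
def onesUnit (N : ℕ) : EuclideanSpace ℝ (Fin N) :=
  WithLp.toLp 2 (fun _ => 1 / √(N : ℝ))

/-- The rank one perturbation `A + α 1̂ 1̂ᵀ` of `A`. -/
def rankOnePerturbation {N : ℕ} (α : ℝ) (A : Matrix (Fin N) (Fin N) ℝ) :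
    Matrix (Fin N) (Fin N) ℝ :=
  A + α • Matrix.vecMulVec (fun i => onesUnit N i) (fun i => onesUnit N i)

/-- `v` is a vector of Euclidean norm one that is an eigenvector of `A` for the largest (real)
eigenvalue of `A`. -/
def IsTopUnitEigenvector {N : ℕ} (A : Matrix (Fin N) (Fin N) ℝ)
    (v : EuclideanSpace ℝ (Fin N)) : Prop :=
  ‖v‖ = 1 ∧ ∃ l : ℝ, IsGreatest {x : ℝ | Module.End.HasEigenvalue (Matrix.toLin' A) x} l ∧
    A.mulVec (fun i => v i) = l • (fun i => v i)

end

/-!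
Write `u = onesUnit N` and `W = √(2/N) • G`, whose spectrum is asymptotically `[-2, 2]`. Both parts
concern the top eigenvector of `W + α u uᵀ`, the first one with `2 α` in place of `α`.

The largest eigenvalue of `W + α u uᵀ` is a convex function of `α`, and the squared overlap
`(u ⬝ v)²` of a top eigenvector with `u` is a subgradient of it. Hence it suffices to find the
almost sure limit of the largest eigenvalue, which is `spikedTop α`, namely `2` for `α ≤ 1`
and `α + 1 / α` for `α > 1`: this limit is differentiable in `α`, at `α = 1` too, so the
subgradients converge to its derivative, which is the claimed limit (`tendsto_overlap_of_bounds`).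

*Upper bound* (`exists_summable_goe_upper_bound`). By Slepian's inequality
(`slepian_measureReal_exists_le`, proved by Gaussian interpolation), the Gaussian process
`x ↦ xᵀ W x` on the unit sphere, plus an independent variable of variance `2 / N`, is dominated by
`x ↦ (2 / √N) h ⬝ x` for a standard Gaussian vector `h`. Splitting `x` into its components along and
orthogonal to `u`, the maximum of `(2 / √N) h ⬝ x + β (u ⬝ x)²` is about
`max_c (2 c + β (1 - c²)) ≤ β + 1 / β`, up to exponentially small probabilities. The passage from
finitely many `x` to the sphere costs nothing, as the bounds do not depend on the number of points.

*Lower bound* (`eventually_exists_lt_quadForm`). Gaussian integration by parts gives the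
Schwinger–Dyson equations for `tr (W ^ k) / N` and `⟨u, W ^ k u⟩` (`GOEModel.E_moment_succ_mul`). An
induction on the total degree shows that all mixed moments of the deviations of these variables from
the semicircle moments, rescaled by `√N`, are bounded (`GOEModel.exists_abs_E_prod_fluct_le`). In
particular the fourth moments of the deviations are `O(N⁻²)`, so `⟨u, p(W) u⟩` converges almost
surely to the semicircle integral of `p`, for each polynomial `p`. The vector `p(W) u` with
`p = ∑ j ≤ K, γ ^ j U_j`, where the `U_j` are the Chebyshev polynomials orthonormal for the
semicircle law and `γ = min 1 (1 / α)`, has a Rayleigh quotient that tends to `spikedTop α` as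
`K → ∞`.

Both bounds hold outside events of summable probability, so the joint law of the matrices plays no
role.
-/

/-! ### Gaussian integration by parts -/

/-- The law of a family of independent standard Gaussian variables indexed by a finite type. -/
noncomputable abbrev gaussianPi (κ : Type*) [Fintype κ] : Measure (κ → ℝ) :=
  Measure.pi fun _ : κ => gaussianReal 0 1

theorem gaussianPDFReal_zero_one_hasDerivAt (t : ℝ) :
    HasDerivAt (gaussianPDFReal 0 1) (-(t * gaussianPDFReal 0 1 t)) t := by
  have h : HasDerivAt (fun x : ℝ => -(x - 0) ^ 2 / (2 * ((1 : NNReal) : ℝ))) (-t) t := by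
    have := (((hasDerivAt_id t).sub_const 0).pow 2).neg.div_const (2 * ((1 : NNReal) : ℝ))
    refine this.congr_deriv ?_
    simp only [NNReal.coe_one, id_eq, sub_zero]
    norm_num
    ring
  have h2 := (h.exp).const_mul (√(2 * Real.pi * ((1 : NNReal) : ℝ)))⁻¹
  rw [gaussianPDFReal_def]
  refine h2.congr_deriv ?_
  ring

theorem integrable_gaussianReal_iff {f : ℝ → ℝ} :
    Integrable f (gaussianReal 0 1) ↔ Integrable (fun x => f x * gaussianPDFReal 0 1 x) := by
  rw [gaussianReal_of_var_ne_zero 0 one_ne_zero,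
    integrable_withDensity_iff (measurable_gaussianPDF 0 1)
      (ae_of_all _ fun _ => gaussianPDF_lt_top)]
  simp only [toReal_gaussianPDF]

/-- Stein's identity for one standard Gaussian variable. -/
theorem integral_id_mul_gaussianReal {f f' : ℝ → ℝ} (hf : ∀ t, HasDerivAt f (f' t) t)
    (h0 : Integrable f (gaussianReal 0 1)) (h1 : Integrable f' (gaussianReal 0 1))
    (h2 : Integrable (fun t => t * f t) (gaussianReal 0 1)) :
    ∫ t, t * f t ∂gaussianReal 0 1 = ∫ t, f' t ∂gaussianReal 0 1 := by
  rw [integrable_gaussianReal_iff] at h0 h1 h2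
  rw [integral_gaussianReal_eq_integral_smul one_ne_zero,
    integral_gaussianReal_eq_integral_smul one_ne_zero]
  have := integral_mul_deriv_eq_deriv_mul_of_integrable (fun x _ => hf x)
    (fun x _ => gaussianPDFReal_zero_one_hasDerivAt x)
    (by
      refine h2.neg.congr (ae_of_all _ fun x => ?_)
      simp only [Pi.neg_apply, Pi.mul_apply]; ring) h1 h0
  calc _ = - ∫ x, f x * -(x * gaussianPDFReal 0 1 x) := by
        rw [← integral_neg]
        congr 1; ext x; simp only [smul_eq_mul]; ring
    _ = _ := by
        rw [this, neg_neg]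
        congr 1; ext x; simp only [smul_eq_mul]; ring

section
variable {κ : Type*} [Fintype κ] [DecidableEq κ]

/-- Replacing one coordinate of a standard Gaussian vector by an independent standard Gaussian
variable does not change the law. -/
theorem measurePreserving_update_gaussianPi (p : κ) :
    MeasurePreserving (fun z : (κ → ℝ) × ℝ => Function.update z.1 p z.2)
      ((gaussianPi κ).prod (gaussianReal 0 1)) (gaussianPi κ) := by
  have hm : Measurable (fun z : (κ → ℝ) × ℝ => Function.update z.1 p z.2) := by
    rw [measurable_pi_iff]
    intro q
    by_cases h : q = p
    · subst h; simpa using measurable_snd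
    · simp only [Function.update_of_ne h]; fun_prop
  refine ⟨hm, (Measure.pi_eq fun s hs => ?_).symm⟩
  rw [Measure.map_apply hm (MeasurableSet.univ_pi hs)]
  have : (fun z : (κ → ℝ) × ℝ => Function.update z.1 p z.2) ⁻¹' Set.univ.pi s =
      (Set.univ.pi (Function.update s p Set.univ)) ×ˢ (s p) := by
    ext z
    simp only [Set.mem_preimage, Set.mem_pi, Set.mem_univ, true_implies, Set.mem_prod]
    constructor
    · intro h
      refine ⟨fun q => ?_, by simpa using h p⟩
      by_cases hq : q = p
      · subst hq; simp
      · simpa [Function.update_of_ne hq] using h q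
    · rintro ⟨h, h'⟩ q
      by_cases hq : q = p
      · subst hq; simpa using h'
      · simpa [Function.update_of_ne hq] using h q
  rw [this, Measure.prod_prod, Measure.pi_pi, ← Finset.mul_prod_erase _ _ (Finset.mem_univ p),
    ← Finset.mul_prod_erase Finset.univ (fun i => gaussianReal 0 1 (s i)) (Finset.mem_univ p)]
  simp only [Function.update_self, measure_univ, one_mul]
  rw [mul_comm]
  congr 1
  refine Finset.prod_congr rfl fun q hq => ?_
  rw [Function.update_of_ne (Finset.ne_of_mem_erase hq)]

/-- Gaussian integration by parts in one coordinate of a standard Gaussian vector. -/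
theorem integral_coord_mul_gaussianPi (p : κ) {f f' : (κ → ℝ) → ℝ}
    (hf : ∀ g t, HasDerivAt (fun s => f (Function.update g p s)) (f' (Function.update g p t)) t)
    (h0 : Integrable f (gaussianPi κ)) (h1 : Integrable f' (gaussianPi κ))
    (h2 : Integrable (fun g => g p * f g) (gaussianPi κ)) :
    ∫ g, g p * f g ∂gaussianPi κ = ∫ g, f' g ∂gaussianPi κ := by
  have hp := measurePreserving_update_gaussianPi (κ := κ) p
  have key : ∀ {φ : (κ → ℝ) → ℝ}, Integrable φ (gaussianPi κ) →
      Integrable (fun z : (κ → ℝ) × ℝ => φ (Function.update z.1 p z.2))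
        ((gaussianPi κ).prod (gaussianReal 0 1)) ∧
      ∫ g, φ g ∂gaussianPi κ =
        ∫ g, ∫ t, φ (Function.update g p t) ∂gaussianReal 0 1 ∂gaussianPi κ := by
    intro φ hφ
    have hi := hp.integrable_comp_of_integrable hφ
    refine ⟨hi, ?_⟩
    refine Eq.trans ?_ (integral_prod _ hi)
    conv_lhs => rw [← hp.map_eq]
    exact integral_map hp.measurable.aemeasurable (by rw [hp.map_eq]; exact hφ.1)
  rw [(key h2).2, (key h1).2]
  refine integral_congr_ae ?_
  filter_upwards [(key h0).1.prod_right_ae, (key h1).1.prod_right_ae, (key h2).1.prod_right_ae]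
    with g i0 i1 i2
  simp only [Function.update_self] at i2 ⊢
  exact integral_id_mul_gaussianReal (hf g) i0 i1 i2

end

theorem integrable_coord_gaussianPi {κ : Type*} [Fintype κ] (p : κ) :
    Integrable (fun g => g p) (gaussianPi κ) := by
  have h : Integrable (fun t : ℝ => t) (gaussianReal 0 1) :=
    memLp_one_iff_integrable.1 (memLp_id_gaussianReal' 1 (by simp))
  exact (measurePreserving_eval (fun _ : κ => gaussianReal 0 1) p).integrable_comp_of_integrable h

/-! ### Slepian's inequality -/

/-- The Gaussian vector with coefficient matrix `M`. -/
noncomputable def linForm {S κ : Type*} [Fintype κ] (M : S → κ → ℝ) (g : κ → ℝ) : S → ℝ :=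
  fun x => ∑ p, M x p * g p

theorem continuous_linForm {S κ : Type*} [Fintype κ] (M : S → κ → ℝ) : Continuous (linForm M) := by
  unfold linForm; fun_prop

section Slepian
variable {S κ : Type*} [Fintype S] [Fintype κ]

/-- A smooth substitute for the indicator of the orthant `{z | ∀ x, z x < τ x}`; it converges to
that indicator off the boundary as `b → ∞`. -/
noncomputable def softOrthant (b : ℝ) (τ z : S → ℝ) : ℝ :=
  Real.exp (-∑ x, Real.exp (b * (z x - τ x)))

theorem softOrthant_pos (b : ℝ) (τ z : S → ℝ) : 0 < softOrthant b τ z := Real.exp_pos _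

theorem softOrthant_le_one (b : ℝ) (τ z : S → ℝ) : softOrthant b τ z ≤ 1 :=
  Real.exp_le_one_iff.2 (neg_nonpos.2 (Finset.sum_nonneg fun _ _ => (Real.exp_pos _).le))

theorem exp_mul_softOrthant_le_one (b : ℝ) (τ z : S → ℝ) (x : S) :
    Real.exp (b * (z x - τ x)) * softOrthant b τ z ≤ 1 := by
  have h1 : Real.exp (b * (z x - τ x)) ≤ ∑ y, Real.exp (b * (z y - τ y)) :=
    Finset.single_le_sum (f := fun y => Real.exp (b * (z y - τ y)))
      (fun y _ => (Real.exp_pos _).le) (Finset.mem_univ x)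
  unfold softOrthant
  set s := ∑ y, Real.exp (b * (z y - τ y))
  have h2 := Real.add_one_le_exp s
  have h3 : Real.exp s * Real.exp (-s) = 1 := by rw [← Real.exp_add]; simp
  nlinarith [Real.exp_pos (-s), Real.exp_pos s]

theorem exp_mul_exp_mul_softOrthant_le_two (b : ℝ) (τ z : S → ℝ) (x y : S) :
    Real.exp (b * (z x - τ x)) * Real.exp (b * (z y - τ y)) * softOrthant b τ z ≤ 2 := by
  have h1 : ∀ w, Real.exp (b * (z w - τ w)) ≤ ∑ y, Real.exp (b * (z y - τ y)) := fun w =>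
    Finset.single_le_sum (f := fun y => Real.exp (b * (z y - τ y)))
      (fun y _ => (Real.exp_pos _).le) (Finset.mem_univ w)
  have hx := h1 x
  have hy := h1 y
  unfold softOrthant
  set s := ∑ y, Real.exp (b * (z y - τ y))
  have hs : 0 ≤ s := (Real.exp_pos _).le.trans hx
  have h2 := Real.quadratic_le_exp_of_nonneg hs
  have h3 : Real.exp s * Real.exp (-s) = 1 := by rw [← Real.exp_add]; simp
  have h4 : Real.exp (b * (z x - τ x)) * Real.exp (b * (z y - τ y)) ≤ s * s :=
    mul_le_mul hx hy (Real.exp_pos _).le hs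
  have h5 : s * s ≤ 2 * Real.exp s := by nlinarith
  calc _ ≤ (2 * Real.exp s) * Real.exp (-s) :=
        mul_le_mul_of_nonneg_right (h4.trans h5) (Real.exp_pos _).le
    _ = 2 := by rw [mul_assoc, h3, mul_one]

theorem continuous_softOrthant (b : ℝ) (τ : S → ℝ) : Continuous (softOrthant b τ) := by
  unfold softOrthant; fun_prop

theorem hasDerivAt_softOrthant (b : ℝ) (τ : S → ℝ) {z : ℝ → S → ℝ} {z' : S → ℝ} {t : ℝ}
    (hz : ∀ x, HasDerivAt (fun s => z s x) (z' x) t) :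
    HasDerivAt (fun s => softOrthant b τ (z s))
      (-b * ∑ x, z' x * (Real.exp (b * (z t x - τ x)) * softOrthant b τ (z t))) t := by
  have h1 : HasDerivAt (fun s => ∑ x, Real.exp (b * (z s x - τ x)))
      (∑ x, Real.exp (b * (z t x - τ x)) * (b * z' x)) t :=
    HasDerivAt.fun_sum fun x _ => (((hz x).sub_const _).const_mul b).exp
  refine (h1.fun_neg.exp).congr_deriv ?_
  simp only [softOrthant, Finset.mul_sum, mul_neg]
  rw [← Finset.sum_neg_distrib]
  refine Finset.sum_congr rfl fun x _ => ?_
  ring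

theorem hasDerivAt_exp_mul_softOrthant (b : ℝ) (τ : S → ℝ) {z : ℝ → S → ℝ} {z' : S → ℝ} {t : ℝ}
    (hz : ∀ x, HasDerivAt (fun s => z s x) (z' x) t) (y : S) :
    HasDerivAt (fun s => Real.exp (b * (z s y - τ y)) * softOrthant b τ (z s))
      (b * z' y * (Real.exp (b * (z t y - τ y)) * softOrthant b τ (z t)) -
        b * ∑ x, z' x * (Real.exp (b * (z t x - τ x)) * Real.exp (b * (z t y - τ y)) *
          softOrthant b τ (z t))) t := by
  refine (((((hz y).sub_const _).const_mul b).exp).mul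
    (hasDerivAt_softOrthant b τ hz)).congr_deriv ?_
  have hs : ∑ x, z' x * (Real.exp (b * (z t x - τ x)) * Real.exp (b * (z t y - τ y)) *
      softOrthant b τ (z t)) = Real.exp (b * (z t y - τ y)) *
      ∑ x, z' x * (Real.exp (b * (z t x - τ x)) * softOrthant b τ (z t)) := by
    rw [Finset.mul_sum]
    refine Finset.sum_congr rfl fun x _ => ?_
    ring
  rw [hs]
  ring

theorem integrable_exp_mul_softOrthant (b : ℝ) (τ : S → ℝ) (M : S → κ → ℝ) (y : S) :
    Integrable (fun g => Real.exp (b * (linForm M g y - τ y)) * softOrthant b τ (linForm M g))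
      (gaussianPi κ) := by
  refine Integrable.of_bound (C := 1) ?_ (ae_of_all _ fun g => ?_)
  · have h1 := continuous_linForm M
    have h2 := (continuous_softOrthant b τ).comp h1
    have h3 : Continuous fun g => linForm M g y := (continuous_apply y).comp h1
    exact (Continuous.mul (by fun_prop) h2).aestronglyMeasurable
  · rw [Real.norm_of_nonneg (mul_nonneg (Real.exp_pos _).le (softOrthant_pos _ _ _).le)]
    exact exp_mul_softOrthant_le_one _ _ _ _

theorem integrable_exp_mul_exp_mul_softOrthant (b : ℝ) (τ : S → ℝ) (M : S → κ → ℝ) (x y : S) :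
    Integrable (fun g => Real.exp (b * (linForm M g x - τ x)) *
      Real.exp (b * (linForm M g y - τ y)) * softOrthant b τ (linForm M g)) (gaussianPi κ) := by
  refine Integrable.of_bound (C := 2) ?_ (ae_of_all _ fun g => ?_)
  · have h1 := continuous_linForm M
    have h2 := (continuous_softOrthant b τ).comp h1
    have h3 : ∀ y, Continuous fun g => linForm M g y := fun y => (continuous_apply y).comp h1
    have h4 := h3 x
    have h5 := h3 y
    exact (Continuous.mul (by fun_prop) h2).aestronglyMeasurable
  · rw [Real.norm_of_nonneg (mul_nonneg (mul_nonneg (Real.exp_pos _).le (Real.exp_pos _).le)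
      (softOrthant_pos _ _ _).le)]
    exact exp_mul_exp_mul_softOrthant_le_two _ _ _ _ _

theorem integrable_softOrthant (b : ℝ) (τ : S → ℝ) (M : S → κ → ℝ) :
    Integrable (fun g => softOrthant b τ (linForm M g)) (gaussianPi κ) := by
  refine Integrable.of_bound (C := 1) ?_ (ae_of_all _ fun g => ?_)
  · exact ((continuous_softOrthant b τ).comp (continuous_linForm M)).aestronglyMeasurable
  · rw [Real.norm_of_nonneg (softOrthant_pos _ _ _).le]
    exact softOrthant_le_one _ _ _

theorem integrable_coord_mul_exp_mul_softOrthant (b : ℝ) (τ : S → ℝ) (M : S → κ → ℝ) (y : S)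
    (p : κ) : Integrable (fun g => g p * (Real.exp (b * (linForm M g y - τ y)) *
      softOrthant b τ (linForm M g))) (gaussianPi κ) := by
  refine (integrable_coord_gaussianPi p).mul_bdd (c := 1)
    (integrable_exp_mul_softOrthant b τ M y).1 (ae_of_all _ fun g => ?_)
  rw [Real.norm_of_nonneg (mul_nonneg (Real.exp_pos _).le (softOrthant_pos _ _ _).le)]
  exact exp_mul_softOrthant_le_one _ _ _ _

theorem integral_coord_mul_exp_mul_softOrthant (b : ℝ) (τ : S → ℝ) (M : S → κ → ℝ) (y : S)
    (p : κ) :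
    ∫ g, g p * (Real.exp (b * (linForm M g y - τ y)) * softOrthant b τ (linForm M g))
        ∂gaussianPi κ =
      b * M y p * ∫ g, Real.exp (b * (linForm M g y - τ y)) * softOrthant b τ (linForm M g)
        ∂gaussianPi κ -
      b * ∑ x, M x p * ∫ g, Real.exp (b * (linForm M g x - τ x)) *
        Real.exp (b * (linForm M g y - τ y)) * softOrthant b τ (linForm M g) ∂gaussianPi κ := by
  classical
  have hd : ∀ (g : κ → ℝ) (t : ℝ) (x : S),
      HasDerivAt (fun s => linForm M (Function.update g p s) x) (M x p) t := by
    intro g t x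
    have : ∀ s, linForm M (Function.update g p s) x =
        M x p * s + ∑ q ∈ Finset.univ.erase p, M x q * g q := by
      intro s
      rw [linForm, ← Finset.add_sum_erase _ _ (Finset.mem_univ p), Function.update_self]
      congr 1
      refine Finset.sum_congr rfl fun q hq => ?_
      rw [Function.update_of_ne (Finset.ne_of_mem_erase hq)]
    simp only [this]
    simpa using ((hasDerivAt_id t).const_mul (M x p)).add_const
      (∑ q ∈ Finset.univ.erase p, M x q * g q)
  have i1 := integrable_exp_mul_softOrthant (κ := κ) b τ M
  have i2 := integrable_exp_mul_exp_mul_softOrthant (κ := κ) b τ M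
  have i3 : Integrable (fun g => ∑ x, M x p * (Real.exp (b * (linForm M g x - τ x)) *
        Real.exp (b * (linForm M g y - τ y)) * softOrthant b τ (linForm M g))) (gaussianPi κ) :=
    integrable_finsetSum _ fun x _ => (i2 x y).const_mul _
  refine (integral_coord_mul_gaussianPi p
    (fun g t => hasDerivAt_exp_mul_softOrthant b τ (hd g t) y) (i1 y)
    (((i1 y).const_mul (b * M y p)).sub (i3.const_mul b))
    (integrable_coord_mul_exp_mul_softOrthant b τ M y p)).trans ?_
  rw [integral_sub' ((i1 y).const_mul (b * M y p)) (i3.const_mul b), integral_const_mul,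
    integral_const_mul, integral_finsetSum _ fun x _ => (i2 x y).const_mul _]
  simp only [integral_const_mul]

/-- Gaussian interpolation: the derivative of `∫ softOrthant` along a path `θ ↦ C θ` of coefficient
matrices, expressed through the derivative of the covariance matrix. -/
theorem hasDerivAt_integral_softOrthant (b : ℝ) (τ : S → ℝ) (C C' : ℝ → S → κ → ℝ) (R : ℝ)
    (hC : ∀ x p t, HasDerivAt (fun s => C s x p) (C' t x p) t)
    (hR : ∀ x p t, |C' t x p| ≤ R) (θ : ℝ) :
    HasDerivAt (fun t => ∫ g, softOrthant b τ (linForm (C t) g) ∂gaussianPi κ)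
      (-b * ∑ y, ∑ p, C' θ y p *
        ∫ g, g p * (Real.exp (b * (linForm (C θ) g y - τ y)) * softOrthant b τ (linForm (C θ) g))
          ∂gaussianPi κ) θ := by
  have hd : ∀ (g : κ → ℝ) (t : ℝ), HasDerivAt (fun s => softOrthant b τ (linForm (C s) g))
      (-b * ∑ y, (∑ p, C' t y p * g p) * (Real.exp (b * (linForm (C t) g y - τ y)) *
        softOrthant b τ (linForm (C t) g))) t := by
    intro g t
    refine hasDerivAt_softOrthant b τ fun x => ?_
    exact HasDerivAt.fun_sum fun p _ => (hC x p t).mul_const _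
  have hi : ∀ p, Integrable (fun g : κ → ℝ => |g p|) (gaussianPi κ) :=
    fun p => (integrable_coord_gaussianPi p).abs
  have hcont : Continuous fun g => -b * ∑ y, (∑ p, C' θ y p * g p) *
      (Real.exp (b * (linForm (C θ) g y - τ y)) * softOrthant b τ (linForm (C θ) g)) := by
    have h1 := continuous_linForm (C θ)
    have h2 : Continuous fun g => softOrthant b τ (linForm (C θ) g) :=
      (continuous_softOrthant b τ).comp h1
    have h3 : ∀ y, Continuous fun g => linForm (C θ) g y := fun y => (continuous_apply y).comp h1
    fun_prop
  have h := hasDerivAt_integral_of_dominated_loc_of_deriv_le (μ := gaussianPi κ) (x₀ := θ)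
    (s := Set.univ) (F := fun t g => softOrthant b τ (linForm (C t) g))
    (F' := fun t g => -b * ∑ y, (∑ p, C' t y p * g p) *
      (Real.exp (b * (linForm (C t) g y - τ y)) * softOrthant b τ (linForm (C t) g)))
    (bound := fun g => |b| * ∑ _y : S, ∑ p, R * |g p|) Filter.univ_mem
    (Eventually.of_forall fun t => (integrable_softOrthant b τ (C t)).1)
    (integrable_softOrthant b τ (C θ)) hcont.aestronglyMeasurable
    (ae_of_all _ fun g t _ => by
      rw [norm_mul, Real.norm_eq_abs, abs_neg]
      refine mul_le_mul_of_nonneg_left ?_ (abs_nonneg b)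
      refine (norm_sum_le _ _).trans (Finset.sum_le_sum fun y _ => ?_)
      rw [norm_mul, Real.norm_of_nonneg (mul_nonneg (Real.exp_pos _).le
        (softOrthant_pos b τ (linForm (C t) g)).le)]
      refine (mul_le_of_le_one_right (norm_nonneg _) (exp_mul_softOrthant_le_one _ _ _ _)).trans ?_
      refine (norm_sum_le _ _).trans (Finset.sum_le_sum fun p _ => ?_)
      rw [norm_mul]
      exact mul_le_mul_of_nonneg_right (hR y p t) (norm_nonneg _))
    ((integrable_finsetSum _ fun y _ => integrable_finsetSum _ fun p _ =>
      (hi p).const_mul R).const_mul _)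
    (ae_of_all _ fun g t _ => hd g t)
  refine h.2.congr_deriv ?_
  rw [integral_const_mul]
  congr 1
  have e : ∀ g : κ → ℝ, ∑ y, (∑ p, C' θ y p * g p) * (Real.exp (b * (linForm (C θ) g y - τ y)) *
      softOrthant b τ (linForm (C θ) g)) = ∑ y, ∑ p, C' θ y p *
      (g p * (Real.exp (b * (linForm (C θ) g y - τ y)) * softOrthant b τ (linForm (C θ) g))) := by
    intro g
    refine Finset.sum_congr rfl fun y _ => ?_
    rw [Finset.sum_mul]
    refine Finset.sum_congr rfl fun p _ => ?_
    ring
  simp only [e]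
  have ii := fun y p => (integrable_coord_mul_exp_mul_softOrthant b τ (C θ) y p).const_mul
    (C' θ y p)
  rw [integral_finsetSum _ fun y _ => integrable_finsetSum _ fun p _ => ii y p]
  refine Finset.sum_congr rfl fun y _ => ?_
  rw [integral_finsetSum _ fun p _ => ii y p]
  simp only [integral_const_mul]

/-- The smooth form of Slepian's inequality: of two uncorrelated centred Gaussian families with
equal variances, the more correlated one is more likely to stay below the thresholds `τ`. -/
theorem integral_softOrthant_le (b : ℝ) (τ : S → ℝ) (A B : S → κ → ℝ)
    (horth : ∀ x y, ∑ p, A x p * B y p = 0)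
    (hdiag : ∀ x, ∑ p, A x p * A x p = ∑ p, B x p * B x p)
    (hcov : ∀ x y, ∑ p, B x p * B y p ≤ ∑ p, A x p * A y p) :
    ∫ g, softOrthant b τ (linForm B g) ∂gaussianPi κ ≤
      ∫ g, softOrthant b τ (linForm A g) ∂gaussianPi κ := by
  set C : ℝ → S → κ → ℝ := fun t x p => Real.cos t * A x p + Real.sin t * B x p with hCdef
  set C' : ℝ → S → κ → ℝ := fun t x p => -Real.sin t * A x p + Real.cos t * B x p with hC'def
  have hC : ∀ x p t, HasDerivAt (fun s => C s x p) (C' t x p) t := fun x p t =>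
    ((Real.hasDerivAt_cos t).mul_const _).add ((Real.hasDerivAt_sin t).mul_const _)
  have hR : ∀ x p t, |C' t x p| ≤ ∑ x, ∑ p, (|A x p| + |B x p|) := by
    intro x p t
    have h1 : |A x p| + |B x p| ≤ ∑ p, (|A x p| + |B x p|) :=
      Finset.single_le_sum (f := fun p => |A x p| + |B x p|) (fun _ _ => by positivity)
        (Finset.mem_univ p)
    have h2 : ∑ p, (|A x p| + |B x p|) ≤ ∑ x, ∑ p, (|A x p| + |B x p|) :=
      Finset.single_le_sum (f := fun x => ∑ p, (|A x p| + |B x p|)) (fun _ _ => by positivity)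
        (Finset.mem_univ x)
    refine le_trans ?_ (h1.trans h2)
    refine (abs_add_le _ _).trans (add_le_add ?_ ?_)
    · rw [abs_mul, abs_neg]
      exact mul_le_of_le_one_left (abs_nonneg _) (Real.abs_sin_le_one t)
    · rw [abs_mul]
      exact mul_le_of_le_one_left (abs_nonneg _) (Real.abs_cos_le_one t)
  have hder := hasDerivAt_integral_softOrthant b τ C C' _ hC hR
  set H : ℝ → ℝ := fun t => ∫ g, softOrthant b τ (linForm (C t) g) ∂gaussianPi κ with hH
  have hK : ∀ t x y, ∑ p, C' t x p * C t y p =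
      Real.sin t * Real.cos t * (∑ p, B x p * B y p - ∑ p, A x p * A y p) := by
    intro t x y
    have e1 : ∑ p, C' t x p * C t y p =
        Real.sin t * Real.cos t * (∑ p, B x p * B y p - ∑ p, A x p * A y p)
        - Real.sin t * Real.sin t * ∑ p, A x p * B y p
        + Real.cos t * Real.cos t * ∑ p, A y p * B x p := by
      rw [← Finset.sum_sub_distrib, Finset.mul_sum, Finset.mul_sum, Finset.mul_sum,
        ← Finset.sum_sub_distrib, ← Finset.sum_add_distrib]
      refine Finset.sum_congr rfl fun p _ => ?_
      simp only [hCdef, hC'def]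
      ring
    rw [e1, horth, horth]
    ring
  have hneg : ∀ t ∈ interior (Set.Icc 0 (Real.pi / 2)), deriv H t ≤ 0 := by
    intro t ht
    rw [interior_Icc] at ht
    have hs : 0 ≤ Real.sin t := Real.sin_nonneg_of_nonneg_of_le_pi ht.1.le (by linarith [ht.2,
      Real.pi_pos])
    have hc : 0 ≤ Real.cos t := Real.cos_nonneg_of_mem_Icc ⟨by linarith [ht.1, Real.pi_pos],
      ht.2.le⟩
    rw [(hder t).deriv]
    set I1 : S → ℝ := fun y => ∫ g, Real.exp (b * (linForm (C t) g y - τ y)) *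
      softOrthant b τ (linForm (C t) g) ∂gaussianPi κ
    set I2 : S → S → ℝ := fun x y => ∫ g, Real.exp (b * (linForm (C t) g x - τ x)) *
        Real.exp (b * (linForm (C t) g y - τ y)) * softOrthant b τ (linForm (C t) g) ∂gaussianPi κ
      with hI2
    have hI2n : ∀ x y, 0 ≤ I2 x y := fun x y => integral_nonneg fun g =>
      mul_nonneg (mul_nonneg (Real.exp_pos _).le (Real.exp_pos _).le) (softOrthant_pos _ _ _).le
    have e : ∀ y, ∑ p, C' t y p * ∫ g, g p * (Real.exp (b * (linForm (C t) g y - τ y)) *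
        softOrthant b τ (linForm (C t) g)) ∂gaussianPi κ =
        b * I1 y * ∑ p, C' t y p * C t y p - b * ∑ x, I2 x y * ∑ p, C' t y p * C t x p := by
      intro y
      have e3 : ∀ p, ∫ g, g p * (Real.exp (b * (linForm (C t) g y - τ y)) *
          softOrthant b τ (linForm (C t) g)) ∂gaussianPi κ =
          b * C t y p * I1 y - b * ∑ x, C t x p * I2 x y := fun p =>
        integral_coord_mul_exp_mul_softOrthant b τ (C t) y p
      simp only [e3]
      simp only [mul_sub, Finset.sum_sub_distrib, Finset.mul_sum]
      congr 1
      · refine Finset.sum_congr rfl fun p _ => ?_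
        ring
      · rw [Finset.sum_comm]
        refine Finset.sum_congr rfl fun x _ => Finset.sum_congr rfl fun p _ => ?_
        ring
    have e2 : ∀ y, ∑ p, C' t y p * ∫ g, g p * (Real.exp (b * (linForm (C t) g y - τ y)) *
        softOrthant b τ (linForm (C t) g)) ∂gaussianPi κ =
        b * ∑ x, I2 x y * (Real.sin t * Real.cos t *
          (∑ p, A y p * A x p - ∑ p, B y p * B x p)) := by
      intro y
      rw [e, hK, hdiag, sub_self, mul_zero, mul_zero, zero_sub, ← mul_neg, ← Finset.sum_neg_distrib]
      congr 1
      refine Finset.sum_congr rfl fun x _ => ?_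
      rw [hK]
      ring
    simp only [e2, ← Finset.mul_sum]
    have : 0 ≤ ∑ y, ∑ x, I2 x y * (Real.sin t * Real.cos t *
          (∑ p, A y p * A x p - ∑ p, B y p * B x p)) :=
      Finset.sum_nonneg fun y _ => Finset.sum_nonneg fun x _ =>
        mul_nonneg (hI2n x y) (mul_nonneg (mul_nonneg hs hc) (sub_nonneg.2 (hcov y x)))
    nlinarith [mul_nonneg (mul_self_nonneg b) this]
  have hanti : AntitoneOn H (Set.Icc 0 (Real.pi / 2)) :=
    antitoneOn_of_deriv_nonpos (convex_Icc _ _)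
      (fun t _ => (hder t).continuousAt.continuousWithinAt)
      (fun t _ => (hder t).differentiableAt.differentiableWithinAt) hneg
  have hp : (0 : ℝ) ≤ Real.pi / 2 := by positivity
  have := hanti (Set.left_mem_Icc.2 hp) (Set.right_mem_Icc.2 hp) hp
  simpa [hH, hCdef] using this

/-- Slepian's inequality for the probability of exceeding one of finitely many thresholds, up to the
factor `2` and an arbitrarily small decrease `δ` of the thresholds. -/
theorem slepian_measureReal_exists_le (τ : S → ℝ) (A B : S → κ → ℝ)
    (horth : ∀ x y, ∑ p, A x p * B y p = 0)
    (hdiag : ∀ x, ∑ p, A x p * A x p = ∑ p, B x p * B x p)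
    (hcov : ∀ x y, ∑ p, B x p * B y p ≤ ∑ p, A x p * A y p) {δ : ℝ} (hδ : 0 < δ) :
    (gaussianPi κ).real {g | ∃ x, τ x ≤ linForm A g x} ≤
      2 * (gaussianPi κ).real {g | ∃ x, τ x - δ ≤ linForm B g x} := by
  set EA : Set (κ → ℝ) := {g | ∃ x, τ x ≤ linForm A g x} with hEA
  set EB : Set (κ → ℝ) := {g | ∃ x, τ x - δ ≤ linForm B g x} with hEB
  have hmeas : ∀ (M : S → κ → ℝ) (σ : S → ℝ), MeasurableSet {g | ∃ x, σ x ≤ linForm M g x} := by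
    intro M σ
    rw [Set.ofPred_exists]
    refine MeasurableSet.iUnion fun x => ?_
    exact measurableSet_le measurable_const
      ((measurable_pi_apply x).comp (continuous_linForm M).measurable)
  have mA : MeasurableSet EA := hmeas A τ
  have mB : MeasurableSet EB := hmeas B (fun x => τ x - δ)
  have key : ∀ b : ℝ, 0 ≤ b → (gaussianPi κ).real EA ≤
      2 * ((gaussianPi κ).real EB + Fintype.card S * Real.exp (-(b * δ))) := by
    intro b hb
    have h1 : ∀ g, softOrthant b τ (linForm A g) ≤ 1 - 1 / 2 * EA.indicator 1 g := by
      intro g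
      by_cases hg : g ∈ EA
      · obtain ⟨x, hx⟩ := hg
        rw [Set.indicator_of_mem (show g ∈ EA from ⟨x, hx⟩)]
        have h2 : 1 ≤ Real.exp (b * (linForm A g x - τ x)) :=
          Real.one_le_exp (mul_nonneg hb (sub_nonneg.2 hx))
        have h3 : Real.exp (b * (linForm A g x - τ x)) ≤
            ∑ y, Real.exp (b * (linForm A g y - τ y)) :=
          Finset.single_le_sum (f := fun y => Real.exp (b * (linForm A g y - τ y)))
            (fun y _ => (Real.exp_pos _).le) (Finset.mem_univ x)
        unfold softOrthant
        set s := ∑ y, Real.exp (b * (linForm A g y - τ y))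
        have h4 := Real.add_one_le_exp s
        have h5 : Real.exp s * Real.exp (-s) = 1 := by rw [← Real.exp_add]; simp
        simp only [Pi.one_apply]
        nlinarith [Real.exp_pos (-s)]
      · rw [Set.indicator_of_notMem hg]
        simpa using softOrthant_le_one b τ (linForm A g)
    have h2 : ∀ g, 1 - (EB.indicator 1 g + Fintype.card S * Real.exp (-(b * δ))) ≤
        softOrthant b τ (linForm B g) := by
      intro g
      have hp : (0 : ℝ) ≤ Fintype.card S * Real.exp (-(b * δ)) := by positivity
      by_cases hg : g ∈ EB
      · rw [Set.indicator_of_mem hg]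
        simp only [Pi.one_apply]
        linarith [softOrthant_pos b τ (linForm B g)]
      · rw [Set.indicator_of_notMem hg]
        have h3 : ∑ y, Real.exp (b * (linForm B g y - τ y)) ≤
            Fintype.card S * Real.exp (-(b * δ)) := by
          calc _ ≤ ∑ _y : S, Real.exp (-(b * δ)) := by
                refine Finset.sum_le_sum fun y _ => Real.exp_le_exp.2 ?_
                have : linForm B g y < τ y - δ := by
                  by_contra hc
                  exact hg ⟨y, not_lt.1 hc⟩
                nlinarith
            _ = _ := by simp
        have h4 := Real.add_one_le_exp (-∑ y, Real.exp (b * (linForm B g y - τ y)))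
        unfold softOrthant
        linarith
    have iA' : Integrable (fun g => 1 / 2 * EA.indicator (1 : (κ → ℝ) → ℝ) g) (gaussianPi κ) :=
      ((integrable_const (1 : ℝ)).indicator mA).const_mul _
    have iA : Integrable (fun g => 1 - 1 / 2 * EA.indicator (1 : (κ → ℝ) → ℝ) g)
        (gaussianPi κ) :=
      (integrable_const _).sub iA'
    have iB' : Integrable (fun g => EB.indicator (1 : (κ → ℝ) → ℝ) g) (gaussianPi κ) :=
      (integrable_const (1 : ℝ)).indicator mB
    have iC : Integrable (fun g => EB.indicator (1 : (κ → ℝ) → ℝ) g +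
        Fintype.card S * Real.exp (-(b * δ))) (gaussianPi κ) := iB'.add (integrable_const _)
    have iB : Integrable (fun g => 1 - (EB.indicator (1 : (κ → ℝ) → ℝ) g +
        Fintype.card S * Real.exp (-(b * δ)))) (gaussianPi κ) :=
      (integrable_const _).sub iC
    have e1 := integral_mono (integrable_softOrthant b τ A) iA h1
    have e2 := integral_mono iB (integrable_softOrthant b τ B) h2
    have e3 := integral_softOrthant_le b τ A B horth hdiag hcov
    rw [integral_sub (integrable_const _) iA',
      integral_const_mul, integral_indicator_one mA] at e1
    rw [integral_sub (integrable_const _) iC,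
      integral_add iB' (integrable_const _), integral_indicator_one mB] at e2
    simp only [integral_const, probReal_univ, smul_eq_mul, one_mul] at e1 e2
    linarith
  have hlim : Tendsto (fun b : ℝ => 2 * ((gaussianPi κ).real EB +
      Fintype.card S * Real.exp (-(b * δ)))) atTop
      (𝓝 (2 * ((gaussianPi κ).real EB + Fintype.card S * 0))) := by
    refine ((Tendsto.const_mul _ ?_).const_add _).const_mul _
    exact Real.tendsto_exp_neg_atTop_nhds_zero.comp (tendsto_id.atTop_mul_const hδ)
  rw [mul_zero, add_zero] at hlim
  exact ge_of_tendsto hlim (eventually_atTop.2 ⟨0, key⟩)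

end Slepian

/-! ### Chernoff bounds for Gaussian vectors -/

theorem mgf_sq_gaussianReal {t : ℝ} (ht : t < 1 / 2) :
    Integrable (fun x : ℝ => Real.exp (t * x ^ 2)) (gaussianReal 0 1) ∧
      ∫ x, Real.exp (t * x ^ 2) ∂gaussianReal 0 1 = √(1 / (1 - 2 * t)) := by
  have hb : 0 < 1 / 2 - t := by linarith
  have e : ∀ x : ℝ, Real.exp (t * x ^ 2) * gaussianPDFReal 0 1 x =
      (√(2 * Real.pi))⁻¹ * Real.exp (-(1 / 2 - t) * x ^ 2) := by
    intro x
    simp only [gaussianPDFReal, NNReal.coe_one, mul_one, sub_zero]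
    rw [mul_left_comm, ← Real.exp_add]
    congr 2
    ring
  constructor
  · rw [integrable_gaussianReal_iff]
    simp only [e]
    exact (integrable_exp_neg_mul_sq hb).const_mul _
  · rw [integral_gaussianReal_eq_integral_smul one_ne_zero]
    simp only [smul_eq_mul]
    simp only [mul_comm (gaussianPDFReal 0 1 _), e]
    rw [integral_const_mul, integral_gaussian, ← Real.sqrt_inv, ← Real.sqrt_mul (by positivity)]
    congr 1
    have : Real.pi ≠ 0 := Real.pi_ne_zero
    field_simp

section Chernoff
variable {Ω : Type*} [MeasurableSpace Ω] {μ : Measure Ω} [IsProbabilityMeasure μ]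

/-- The length of a standard Gaussian vector in dimension `N` exceeds `(1 + η) √N` with
exponentially small probability. -/
theorem exists_measureReal_sum_sq_ge_le {η : ℝ} (hη : 0 < η) :
    ∃ ρ : ℝ, 0 ≤ ρ ∧ ρ < 1 ∧ ∀ {Ω : Type} [MeasurableSpace Ω] (μ : Measure Ω)
      [IsProbabilityMeasure μ] (N : ℕ) (h : Fin N → Ω → ℝ), (∀ i, Measurable (h i)) →
      (∀ i, μ.map (h i) = gaussianReal 0 1) → iIndepFun h μ →
      μ.real {ω | (1 + η) ^ 2 * N ≤ ∑ i, h i ω ^ 2} ≤ ρ ^ N := by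
  set a := (1 + η) ^ 2 with ha
  have ha1 : 1 < a := by nlinarith
  -- With this exponent `(1 - 2 t) (1 + 2 t a) > 1`, which makes the ratio `ρ` smaller than `1`.
  set t := (a - 1) / (4 * a) with ht
  have ha0 : 0 < a := by linarith
  have ht0 : 0 < t := by rw [ht]; exact div_pos (by linarith) (by linarith)
  have hta : 4 * (t * a) = a - 1 := by rw [ht]; field_simp
  have ht2 : t < 1 / 4 := by
    rw [ht, div_lt_div_iff₀ (by linarith) (by norm_num)]; linarith
  refine ⟨Real.exp (-t * a) * √(1 / (1 - 2 * t)), by positivity, ?_, ?_⟩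
  · have h1 : (Real.exp (-t * a) * √(1 / (1 - 2 * t))) ^ 2 < 1 := by
      rw [mul_pow, Real.sq_sqrt (by apply div_nonneg <;> linarith), ← Real.exp_nat_mul,
        mul_one_div, div_lt_one (by linarith)]
      have h2 := Real.add_one_le_exp (2 * (t * a))
      have h3 : Real.exp (2 * (t * a)) * Real.exp ((2 : ℕ) * (-t * a)) = 1 := by
        rw [← Real.exp_add]; push_cast
        rw [show 2 * (t * a) + 2 * (-t * a) = 0 by ring, Real.exp_zero]
      have h4 := Real.exp_pos ((2 : ℕ) * (-t * a))
      have h5 : 1 < (1 - 2 * t) * (2 * (t * a) + 1) := by nlinarith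
      have h6 : 1 < (1 - 2 * t) * Real.exp (2 * (t * a)) := by nlinarith
      nlinarith
    have h0 : 0 ≤ Real.exp (-t * a) * √(1 / (1 - 2 * t)) := by positivity
    nlinarith
  · intro Ω _ μ _ N h hm hlaw hind
    have hmg : ∀ i, Integrable (fun ω => Real.exp (t * h i ω ^ 2)) μ ∧
        mgf (fun ω => h i ω ^ 2) μ t = √(1 / (1 - 2 * t)) := by
      intro i
      have hg := mgf_sq_gaussianReal (t := t) (by linarith)
      rw [← hlaw i] at hg
      constructor
      · exact (integrable_map_measure hg.1.1 (hm i).aemeasurable).1 hg.1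
      · rw [mgf, ← hg.2, integral_map (hm i).aemeasurable hg.1.1]
    have hm2 : ∀ i, Measurable (fun ω => h i ω ^ 2) := fun i => (hm i).pow_const 2
    have hind2 : iIndepFun (fun i ω => h i ω ^ 2) μ :=
      hind.comp (fun _ x => x ^ 2) fun _ => measurable_id.pow_const 2
    have e : (fun ω => ∑ i, h i ω ^ 2) = ∑ i, fun ω => h i ω ^ 2 := by
      ext ω; simp
    have h1 := measure_ge_le_exp_mul_mgf (μ := μ) (X := ∑ i, fun ω => h i ω ^ 2) (a * N) ht0.le
      (hind2.integrable_exp_mul_sum hm2 fun i _ => (hmg i).1)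
    rw [hind2.mgf_sum hm2, Finset.prod_congr rfl fun i _ => (hmg i).2] at h1
    simp only [Finset.sum_apply, Finset.prod_const, Finset.card_univ, Fintype.card_fin] at h1
    refine h1.trans_eq ?_
    rw [mul_pow, ← Real.exp_nat_mul]
    congr 2
    ring

/-- The Gaussian tail bound for the component of a standard Gaussian vector along a unit vector. -/
theorem measureReal_sum_mul_ge_le {N : ℕ} {h : Fin N → Ω → ℝ} (hm : ∀ i, Measurable (h i))
    (hlaw : ∀ i, μ.map (h i) = gaussianReal 0 1) (hind : iIndepFun h μ) {u : Fin N → ℝ}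
    (hu : ∑ i, u i ^ 2 = 1) {r : ℝ} (hr : 0 ≤ r) :
    μ.real {ω | r ≤ ∑ i, u i * h i ω} ≤ Real.exp (-r ^ 2 / 2) := by
  have hmg : ∀ i, Integrable (fun ω => Real.exp (r * (u i * h i ω))) μ ∧
      mgf (fun ω => u i * h i ω) μ r = Real.exp (r ^ 2 / 2 * u i ^ 2) := by
    intro i
    have hg := integrable_exp_mul_gaussianReal (μ := 0) (v := 1) (r * u i)
    have hg2 := mgf_gaussianReal (hlaw i) (r * u i)
    constructor
    · rw [← hlaw i] at hg
      have := (integrable_map_measure hg.1 (hm i).aemeasurable).1 hg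
      refine this.congr (ae_of_all _ fun ω => ?_)
      simp only [Function.comp_apply]; rw [mul_assoc]
    · rw [mgf] at hg2 ⊢
      simp only [← mul_assoc, hg2]
      congr 1
      simp only [NNReal.coe_one]
      ring
  have hm2 : ∀ i, Measurable (fun ω => u i * h i ω) := fun i => (hm i).const_mul _
  have hind2 : iIndepFun (fun i ω => u i * h i ω) μ :=
    hind.comp (fun i x => u i * x) fun i => measurable_id.const_mul _
  have h1 := measure_ge_le_exp_mul_mgf (μ := μ) (X := ∑ i, fun ω => u i * h i ω) r hr
    (hind2.integrable_exp_mul_sum hm2 fun i _ => (hmg i).1)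
  rw [hind2.mgf_sum hm2, Finset.prod_congr rfl fun i _ => (hmg i).2, ← Real.exp_sum,
    ← Finset.mul_sum, hu, ← Real.exp_add] at h1
  simp only [Finset.sum_apply] at h1
  refine h1.trans_eq ?_
  congr 1
  ring

end Chernoff

/-! ### The Gaussian orthogonal ensemble as a linear image of a standard Gaussian vector -/

/-- The positions on and above the diagonal of an `N × N` matrix. -/
abbrev UpperIdx (N : ℕ) : Type := {p : Fin N × Fin N // p.1 ≤ p.2}

/-- The position on or above the diagonal that determines the entry `(i, j)` of a symmetric
matrix. -/
def upperIdx {N : ℕ} (i j : Fin N) : UpperIdx N := ⟨(min i j, max i j), min_le_max⟩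

/-- The standard deviations of the entries of the GOE normalised to have spectrum near `[-2, 2]`. -/
noncomputable def goeStd {N : ℕ} (i j : Fin N) : ℝ := if i = j then √(2 / N) else √(1 / N)

/-- The symmetric matrix obtained from a vector of independent standard Gaussian variables, in the
normalisation where the variances are `1 / N` off the diagonal and `2 / N` on it. -/
noncomputable def goeMatrix {N : ℕ} (g : UpperIdx N → ℝ) : Matrix (Fin N) (Fin N) ℝ :=
  fun i j => goeStd i j * g (upperIdx i j)

theorem upperIdx_comm {N : ℕ} (i j : Fin N) : upperIdx i j = upperIdx j i := by
  simp [upperIdx, min_comm, max_comm]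

theorem goeStd_comm {N : ℕ} (i j : Fin N) : goeStd i j = goeStd j i := by
  simp [goeStd, eq_comm]

theorem upperIdx_coe {N : ℕ} (p : UpperIdx N) : upperIdx p.1.1 p.1.2 = p := by
  apply Subtype.ext
  simp [upperIdx, p.2]

/-- The number of entries of a symmetric matrix determined by a position on or above the
diagonal. -/
def upperMult {N : ℕ} (p : UpperIdx N) : ℝ := if p.1.1 = p.1.2 then 1 else 2

theorem sum_sum_eq_sum_upperIdx {N : ℕ} (F : Fin N → Fin N → ℝ) (hF : ∀ i j, F i j = F j i) :
    ∑ i, ∑ j, F i j = ∑ p : UpperIdx N, upperMult p * F p.1.1 p.1.2 := by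
  have h1 : ∀ f : Fin N × Fin N → ℝ, ∑ p : UpperIdx N, f p.1 =
      ∑ i, ∑ j, if i ≤ j then f (i, j) else 0 := by
    intro f
    rw [← Finset.sum_product', ← Finset.sum_filter]
    symm
    refine Finset.sum_subtype _ (fun x => ?_) f
    simp
  unfold upperMult
  rw [h1 fun p => (if p.1 = p.2 then 1 else 2) * F p.1 p.2]
  have h2 : ∑ i, ∑ j, F i j = ∑ i, ∑ j, (if i ≤ j then F i j else 0) +
      ∑ i, ∑ j, (if i < j then F i j else 0) := by
    have : ∑ i, ∑ j, (if i < j then F i j else 0) = ∑ i, ∑ j, (if j < i then F i j else 0) := by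
      rw [Finset.sum_comm]
      refine Finset.sum_congr rfl fun i _ => Finset.sum_congr rfl fun j _ => ?_
      rw [hF]
    rw [this, ← Finset.sum_add_distrib]
    refine Finset.sum_congr rfl fun i _ => ?_
    rw [← Finset.sum_add_distrib]
    refine Finset.sum_congr rfl fun j _ => ?_
    by_cases h : i ≤ j
    · simp [h, not_lt.2 h]
    · simp [h, not_le.1 h]
  rw [h2, ← Finset.sum_add_distrib]
  refine Finset.sum_congr rfl fun i _ => ?_
  rw [← Finset.sum_add_distrib]
  refine Finset.sum_congr rfl fun j _ => ?_
  rcases lt_trichotomy i j with h | h | h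
  · simp [h, h.le, h.ne, two_mul]
  · simp [h]
  · simp [not_le.2 h, not_lt.2 h.le]

/-- The coefficient vector of the Gaussian variable `xᵀ W x`, where `W` is `goeMatrix`. -/
noncomputable def quadCoeff {N : ℕ} (x : Fin N → ℝ) (p : UpperIdx N) : ℝ :=
  upperMult p * goeStd p.1.1 p.1.2 * (x p.1.1 * x p.1.2)

theorem sum_mul_goeMatrix {N : ℕ} (x : Fin N → ℝ) (g : UpperIdx N → ℝ) :
    ∑ i, ∑ j, x i * x j * goeMatrix g i j = ∑ p, quadCoeff x p * g p := by
  rw [sum_sum_eq_sum_upperIdx]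
  · refine Finset.sum_congr rfl fun p _ => ?_
    rw [goeMatrix, upperIdx_coe, quadCoeff]
    ring
  · intro i j
    rw [goeMatrix, goeMatrix, upperIdx_comm, goeStd_comm]
    ring

theorem sum_quadCoeff_mul {N : ℕ} (x y : Fin N → ℝ) :
    ∑ p, quadCoeff x p * quadCoeff y p = 2 / N * (∑ i, x i * y i) ^ 2 := by
  have h : ∀ p : UpperIdx N, quadCoeff x p * quadCoeff y p =
      upperMult p * (2 / N * ((x p.1.1 * y p.1.1) * (x p.1.2 * y p.1.2))) := by
    intro p
    have h1 : √(2 / (N : ℝ)) * √(2 / N) = 2 / N := Real.mul_self_sqrt (by positivity)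
    have h2 : √(1 / (N : ℝ)) * √(1 / N) = 1 / N := Real.mul_self_sqrt (by positivity)
    unfold quadCoeff upperMult goeStd
    split_ifs
    · linear_combination (x p.1.1 * x p.1.2 * (y p.1.1 * y p.1.2)) * h1
    · linear_combination 4 * (x p.1.1 * x p.1.2 * (y p.1.1 * y p.1.2)) * h2
  simp only [h]
  rw [← sum_sum_eq_sum_upperIdx
    (fun i j => 2 / (N : ℝ) * ((x i * y i) * (x j * y j))) (fun i j => by ring), sq,
    Finset.sum_mul_sum, Finset.mul_sum]
  simp only [Finset.mul_sum]

/-! ### Upper bound for the top of the spectrum of a perturbed GOE matrix -/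

theorem gaussianReal_real_Ici_pos : 0 < (gaussianReal 0 1).real (Set.Ici 0) := by
  refine ENNReal.toReal_pos (fun h => ?_) (measure_ne_top _ _)
  have := gaussianReal_absolutelyContinuous' 0 (one_ne_zero) h
  simp at this

theorem measurableSet_exists_le_quadForm {N n : ℕ} (x : Fin n → Fin N → ℝ) (τ : Fin n → ℝ) :
    MeasurableSet {g : UpperIdx N → ℝ |
      ∃ k, τ k ≤ ∑ i, ∑ j, x k i * x k j * goeMatrix g i j} := by
  rw [Set.ofPred_exists]
  refine MeasurableSet.iUnion fun k => measurableSet_le measurable_const ?_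
  unfold goeMatrix
  fun_prop

/-- Comparison of the quadratic form of a GOE matrix, on finitely many unit vectors `x`, with the
linear forms `(2 / √N) h ⬝ x` for a standard Gaussian vector `h`. -/
theorem goe_slepian {N n : ℕ} (x : Fin n → Fin N → ℝ) (hx : ∀ k, ∑ i, x k i * x k i = 1)
    (τ : Fin n → ℝ) {δ : ℝ} (hδ : 0 < δ) :
    (gaussianPi (UpperIdx N)).real {g | ∃ k, τ k ≤ ∑ i, ∑ j, x k i * x k j * goeMatrix g i j} *
        (gaussianReal 0 1).real (Set.Ici 0) ≤
      2 * (gaussianPi (UpperIdx N ⊕ Option (Fin N))).real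
        {g | ∃ k, τ k - δ ≤ 2 / √N * ∑ i, x k i * g (Sum.inr (some i))} := by
  -- Adding an independent variable of variance `2 / N` to `xᵀ W x` equalises the variances; the
  -- remaining difference of covariances is `(2 / N) * (x ⬝ y - 1) ^ 2`.
  set A : Fin n → UpperIdx N ⊕ Option (Fin N) → ℝ := fun k =>
    Sum.elim (quadCoeff (x k)) (fun o => o.elim (√(2 / N)) (fun _ => 0)) with hA
  set B : Fin n → UpperIdx N ⊕ Option (Fin N) → ℝ := fun k =>
    Sum.elim (fun _ => 0) (fun o => o.elim 0 (fun i => 2 / √N * x k i)) with hB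
  have e2 : √(2 / (N : ℝ)) * √(2 / N) = 2 / N := Real.mul_self_sqrt (by positivity)
  have e4 : (2 / √(N : ℝ)) * (2 / √N) = 4 / N := by
    rw [div_mul_div_comm, Real.mul_self_sqrt (by positivity)]; norm_num
  have hAA : ∀ k l, ∑ p, A k p * A l p = 2 / N * (∑ i, x k i * x l i) ^ 2 + 2 / N := by
    intro k l
    rw [Fintype.sum_sum_type, Fintype.sum_option]
    simp only [hA, Sum.elim_inl, Sum.elim_inr, Option.elim, mul_zero, Finset.sum_const_zero,
      add_zero, sum_quadCoeff_mul, e2]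
  have hBB : ∀ k l, ∑ p, B k p * B l p = 4 / N * ∑ i, x k i * x l i := by
    intro k l
    rw [Fintype.sum_sum_type, Fintype.sum_option]
    simp only [hB, Sum.elim_inl, Sum.elim_inr, Option.elim, mul_zero, Finset.sum_const_zero,
      zero_add]
    rw [Finset.mul_sum]
    refine Finset.sum_congr rfl fun i _ => ?_
    linear_combination (x k i * x l i) * e4
  have hs := slepian_measureReal_exists_le τ A B
    (by
      intro k l
      rw [Fintype.sum_sum_type, Fintype.sum_option]
      simp [hA, hB])
    (by intro k; rw [hAA, hBB, hx]; ring)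
    (by
      intro k l
      rw [hAA, hBB]
      have : 0 ≤ 2 / (N : ℝ) * (∑ i, x k i * x l i - 1) ^ 2 := by positivity
      have e : 2 / (N : ℝ) * (∑ i, x k i * x l i - 1) ^ 2 = 2 / N * (∑ i, x k i * x l i) ^ 2 +
          2 / N - 4 / N * ∑ i, x k i * x l i := by ring
      linarith) hδ
  have hlB : ∀ g k, linForm B g k = 2 / √N * ∑ i, x k i * g (Sum.inr (some i)) := by
    intro g k
    rw [linForm, Fintype.sum_sum_type, Fintype.sum_option, Finset.mul_sum]
    simp [hB, mul_assoc]
  have hlA : ∀ g k, linForm A g k = ∑ i, ∑ j, x k i * x k j *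
      goeMatrix (fun p => g (Sum.inl p)) i j + √(2 / N) * g (Sum.inr none) := by
    intro g k
    rw [linForm, Fintype.sum_sum_type, Fintype.sum_option, sum_mul_goeMatrix]
    simp [hA]
  simp only [hlB] at hs
  refine le_trans ?_ hs
  set E := {g : UpperIdx N → ℝ | ∃ k, τ k ≤ ∑ i, ∑ j, x k i * x k j * goeMatrix g i j} with hE
  have mE : MeasurableSet E := measurableSet_exists_le_quadForm x τ
  have mI : MeasurableSet {h : Option (Fin N) → ℝ | h none ∈ Set.Ici (0 : ℝ)} :=
    measurable_pi_apply none measurableSet_Ici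
  have hprod : (gaussianPi (UpperIdx N ⊕ Option (Fin N)))
      ((MeasurableEquiv.sumPiEquivProdPi fun _ => ℝ) ⁻¹'
        (E ×ˢ {h : Option (Fin N) → ℝ | h none ∈ Set.Ici (0 : ℝ)})) =
      gaussianPi (UpperIdx N) E * gaussianReal 0 1 (Set.Ici 0) := by
    rw [(measurePreserving_sumPiEquivProdPi
      (fun _ : UpperIdx N ⊕ Option (Fin N) => gaussianReal 0 1)).measure_preimage
        (mE.prod mI).nullMeasurableSet, Measure.prod_prod]
    congr 1
    exact (measurePreserving_eval (fun _ : Option (Fin N) => gaussianReal 0 1)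
      none).measure_preimage measurableSet_Ici.nullMeasurableSet
  have hprod' := congrArg ENNReal.toReal hprod
  rw [ENNReal.toReal_mul] at hprod'
  rw [measureReal_def, measureReal_def, ← hprod', ← measureReal_def]
  refine measureReal_mono ?_
  rintro g ⟨⟨k, hk⟩, h0⟩
  refine ⟨k, ?_⟩
  rw [hlA]
  have h0' : (0 : ℝ) ≤ g (Sum.inr none) := h0
  have hk' : τ k ≤ ∑ i, ∑ j, x k i * x k j * goeMatrix (fun p => g (Sum.inl p)) i j := hk
  have : 0 ≤ √(2 / (N : ℝ)) * g (Sum.inr none) := mul_nonneg (Real.sqrt_nonneg _) h0'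
  linarith

/-- The maximum over unit vectors `x` of `(2 / √N) h ⬝ x + β (u ⬝ x)²` is nearly at most
`β + 1 / β` as soon as `h` has length nearly at most `√N` and small component along `u`. -/
theorem linear_add_square_le {N : ℕ} (hN : 1 ≤ N) {β η : ℝ} (hβ : 0 < β) (hη : 0 < η)
    {u x h : Fin N → ℝ} (hu : ∑ i, u i ^ 2 = 1) (hx : ∑ i, x i * x i = 1)
    (h1 : ∑ i, h i ^ 2 < (1 + η) ^ 2 * N) (h2 : ∑ i, u i * h i < η * √N)
    (h3 : ∑ i, -u i * h i < η * √N) :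
    2 / √N * ∑ i, x i * h i + β * (∑ i, u i * x i) ^ 2 ≤ β + 1 / β + 4 * η := by
  have hN' : (0 : ℝ) < N := by exact_mod_cast hN
  have hsN : 0 < √(N : ℝ) := Real.sqrt_pos.2 hN'
  set s := ∑ i, u i * x i with hs
  have hcs : ∑ i, (x i - s * u i) ^ 2 = 1 - s ^ 2 := by
    have : ∀ i, (x i - s * u i) ^ 2 = x i * x i - 2 * s * (u i * x i) + s ^ 2 * u i ^ 2 :=
      fun i => by ring
    simp only [this, Finset.sum_add_distrib, Finset.sum_sub_distrib, ← Finset.mul_sum, hx, hu,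
      ← hs]
    ring
  have hc0 : 0 ≤ 1 - s ^ 2 := hcs ▸ Finset.sum_nonneg fun i _ => sq_nonneg _
  set c := √(1 - s ^ 2) with hc
  have hc2 : c ^ 2 = 1 - s ^ 2 := Real.sq_sqrt hc0
  have hcn : 0 ≤ c := Real.sqrt_nonneg _
  have hsabs : |s| ≤ 1 := by
    rw [← sq_le_one_iff_abs_le_one]; linarith
  have hdecomp : ∑ i, x i * h i = s * ∑ i, u i * h i + ∑ i, (x i - s * u i) * h i := by
    rw [Finset.mul_sum, ← Finset.sum_add_distrib]
    refine Finset.sum_congr rfl fun i _ => ?_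
    ring
  have hcsi : ∑ i, (x i - s * u i) * h i ≤ c * ((1 + η) * √N) := by
    refine le_of_sq_le_sq ?_ (by positivity)
    have := Finset.sum_mul_sq_le_sq_mul_sq Finset.univ (fun i => x i - s * u i) h
    rw [hcs] at this
    rw [mul_pow, hc2, mul_pow, Real.sq_sqrt hN'.le]
    exact this.trans (mul_le_mul_of_nonneg_left h1.le hc0)
  have hsh : s * ∑ i, u i * h i ≤ η * √N := by
    simp only [neg_mul, Finset.sum_neg_distrib] at h3
    refine (le_abs_self _).trans ?_
    rw [abs_mul]
    have : |∑ i, u i * h i| ≤ η * √N := abs_le.2 ⟨by linarith, h2.le⟩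
    exact (mul_le_of_le_one_left (abs_nonneg _) hsabs).trans this
  have hmain : 2 / √N * ∑ i, x i * h i ≤ 2 * (η + c * (1 + η)) := by
    rw [hdecomp, div_mul_eq_mul_div, div_le_iff₀ hsN]
    nlinarith
  have hcle : c ≤ 1 := by nlinarith [sq_nonneg s]
  have hamgm : 2 * c ≤ β * c ^ 2 + 1 / β := by
    have : 0 ≤ (β * c - 1) ^ 2 / β := by positivity
    have e : (β * c - 1) ^ 2 / β = β * c ^ 2 + 1 / β - 2 * c := by field_simp; ring
    linarith
  have hss : β * s ^ 2 = β - β * c ^ 2 := by rw [hc2]; ring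
  nlinarith

/-- For a GOE matrix `W` and a unit vector `u`, the largest eigenvalue of `W + β u uᵀ` exceeds
`β + 1 / β + ε` with summable probability. For `β < 1` this bound holds but is not sharp. -/
theorem exists_summable_goe_upper_bound {β ε : ℝ} (hβ : 0 < β) (hε : 0 < ε) :
    ∃ b : ℕ → ℝ, Summable b ∧ ∀ N, 1 ≤ N → ∀ u : Fin N → ℝ, ∑ i, u i ^ 2 = 1 →
      gaussianPi (UpperIdx N) {g | ∃ x : Fin N → ℝ, ∑ i, x i * x i = 1 ∧
        β + 1 / β + ε < ∑ i, ∑ j, x i * x j * goeMatrix g i j + β * (∑ i, u i * x i) ^ 2} ≤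
      ENNReal.ofReal (b N) := by
  set η := ε / 16 with hηdef
  have hη : 0 < η := by positivity
  obtain ⟨ρ, hρ0, hρ1, hρ⟩ := exists_measureReal_sum_sq_ge_le hη
  set c0 := (gaussianReal 0 1).real (Set.Ici 0) with hc0
  have hc0pos : 0 < c0 := gaussianReal_real_Ici_pos
  refine ⟨fun N => 2 * (ρ ^ N + (Real.exp (-η ^ 2 / 2) ^ N + Real.exp (-η ^ 2 / 2) ^ N)) / c0,
    ?_, ?_⟩
  · have h1 := summable_geometric_of_lt_one hρ0 hρ1
    have h2 := summable_geometric_of_lt_one (Real.exp_pos (-η ^ 2 / 2)).le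
      (Real.exp_lt_one_iff.2 (by have := pow_pos hη 2; linarith))
    exact ((h1.add (h2.add h2)).mul_left 2).div_const c0
  intro N hN u hu
  have hN' : (0 : ℝ) < N := by exact_mod_cast hN
  -- the bound on the comparison process
  set κ := UpperIdx N ⊕ Option (Fin N)
  have hind : iIndepFun (fun (i : Fin N) (g : κ → ℝ) => g (Sum.inr (some i))) (gaussianPi κ) :=
    (iIndepFun_pi (μ := fun _ : κ => gaussianReal 0 1) (X := fun _ x => x)
      (fun _ => aemeasurable_id)).precomp (g := fun i : Fin N => (Sum.inr (some i) : κ))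
      (fun i j h => by simpa using h)
  have hlaw : ∀ i : Fin N, (gaussianPi κ).map (fun g => g (Sum.inr (some i))) =
      gaussianReal 0 1 := fun i =>
    (measurePreserving_eval (fun _ : κ => gaussianReal 0 1) (Sum.inr (some i))).map_eq
  have hm : ∀ i : Fin N, Measurable (fun g : κ → ℝ => g (Sum.inr (some i))) :=
    fun i => measurable_pi_apply _
  have hexp : Real.exp (-(η * √N) ^ 2 / 2) = Real.exp (-η ^ 2 / 2) ^ N := by
    rw [← Real.exp_nat_mul, mul_pow, Real.sq_sqrt hN'.le]
    congr 1; ring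
  have hq1 := hρ (gaussianPi κ) N _ hm hlaw hind
  have hq2 := measureReal_sum_mul_ge_le hm hlaw hind hu (r := η * √N) (by positivity)
  have hq3 := measureReal_sum_mul_ge_le hm hlaw hind (u := fun i => -u i) (by simpa using hu)
    (r := η * √N) (by positivity)
  rw [hexp] at hq2 hq3
  have hfin : ∀ (n : ℕ) (x : Fin n → Fin N → ℝ), (∀ k, ∑ i, x k i * x k i = 1) →
      (gaussianPi (UpperIdx N)).real {g | ∃ k, β + 1 / β + ε - β * (∑ i, u i * x k i) ^ 2 ≤
        ∑ i, ∑ j, x k i * x k j * goeMatrix g i j} ≤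
      2 * (ρ ^ N + (Real.exp (-η ^ 2 / 2) ^ N + Real.exp (-η ^ 2 / 2) ^ N)) / c0 := by
    intro n x hx
    rw [le_div_iff₀ hc0pos]
    refine (goe_slepian x hx _ (half_pos hε)).trans (mul_le_mul_of_nonneg_left ?_ zero_le_two)
    refine le_trans ?_ (add_le_add hq1 (add_le_add hq2 hq3))
    refine le_trans (measureReal_mono ?_) ((measureReal_union_le _ _).trans
      (add_le_add_right (measureReal_union_le _ _) _))
    rintro g ⟨k, hk⟩
    by_contra hcon
    simp only [Set.mem_union, not_or] at hcon
    have := linear_add_square_le hN hβ hη hu (hx k) (h := fun i => g (Sum.inr (some i)))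
      (lt_of_not_ge fun h => hcon.1 h) (lt_of_not_ge fun h => hcon.2.1 h)
      (lt_of_not_ge fun h => hcon.2.2 h)
    linarith
  -- passage to the whole sphere, through a countable dense subset
  set T := {x : Fin N → ℝ // ∑ i, x i * x i = 1}
  rcases isEmpty_or_nonempty T with hT | hT
  · refine le_of_eq_of_le ?_ zero_le
    rw [show {g : UpperIdx N → ℝ | ∃ x : Fin N → ℝ, ∑ i, x i * x i = 1 ∧
        β + 1 / β + ε < ∑ i, ∑ j, x i * x j * goeMatrix g i j + β * (∑ i, u i * x i) ^ 2} = ∅ from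
      Set.eq_empty_of_forall_notMem fun g ⟨x, hx, _⟩ => hT.false ⟨x, hx⟩, measure_empty]
  set d : ℕ → T := TopologicalSpace.denseSeq T
  set F : ℕ → Set (UpperIdx N → ℝ) := fun n =>
    {g | ∃ k : Fin n, β + 1 / β + ε - β * (∑ i, u i * (d k).1 i) ^ 2 ≤
        ∑ i, ∑ j, (d k).1 i * (d k).1 j * goeMatrix g i j} with hF
  have hFmono : Monotone F := by
    rintro m n hmn g ⟨k, hk⟩
    exact ⟨Fin.castLE hmn k, hk⟩
  have hsub : {g : UpperIdx N → ℝ | ∃ x : Fin N → ℝ, ∑ i, x i * x i = 1 ∧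
      β + 1 / β + ε < ∑ i, ∑ j, x i * x j * goeMatrix g i j + β * (∑ i, u i * x i) ^ 2} ⊆
      ⋃ n, F n := by
    rintro g ⟨x, hx, hgx⟩
    have hopen : IsOpen {y : T | β + 1 / β + ε <
        ∑ i, ∑ j, y.1 i * y.1 j * goeMatrix g i j + β * (∑ i, u i * y.1 i) ^ 2} := by
      have hc : ∀ i, Continuous fun y : T => y.1 i :=
        fun i => (continuous_apply i).comp continuous_subtype_val
      refine isOpen_lt continuous_const (Continuous.add ?_ ?_)
      · exact continuous_finsetSum _ fun i _ => continuous_finsetSum _ fun j _ =>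
          ((hc i).mul (hc j)).mul continuous_const
      · exact continuous_const.mul ((continuous_finsetSum _ fun i _ =>
          continuous_const.mul (hc i)).pow 2)
    obtain ⟨k, hk⟩ := (TopologicalSpace.denseRange_denseSeq T).exists_mem_open hopen
      ⟨⟨x, hx⟩, hgx⟩
    refine Set.mem_iUnion.2 ⟨k + 1, ⟨k, Nat.lt_succ_self k⟩, ?_⟩
    simp only [Set.mem_ofPred_eq] at hk
    linarith
  refine (measure_mono hsub).trans ?_
  rw [hFmono.measure_iUnion]
  refine iSup_le fun n => ?_
  rw [← ENNReal.ofReal_toReal (measure_ne_top (gaussianPi (UpperIdx N)) (F n))]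
  exact ENNReal.ofReal_le_ofReal (hfin n (fun k => (d k).1) fun k => (d k).2)

/-! ### Schwinger–Dyson equations for the GOE -/

/-- An algebraic model of the GOE in the normalisation with spectrum near `[-2, 2]`: a symmetric
matrix `W` over a commutative algebra of "random variables" with expectation `E`, subject to the
Gaussian integration by parts formula. The derivation `D i j` differentiates in the direction of
the symmetric matrix `e i (e j)ᵀ + e j (e i)ᵀ`. -/
structure GOEModel (N : ℕ) (𝒜 : Type*) [CommRing 𝒜] [Algebra ℝ 𝒜] where
  /-- the expectation -/
  E : 𝒜 →ₗ[ℝ] ℝ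
  /-- the random matrix -/
  W : Matrix (Fin N) (Fin N) 𝒜
  /-- the directional derivatives -/
  D : Fin N → Fin N → Derivation ℝ 𝒜 𝒜
  isSymm : W.IsSymm
  D_W : ∀ i j k l, D i j (W k l) =
    (if k = i then 1 else 0) * (if l = j then 1 else 0) +
      (if k = j then 1 else 0) * (if l = i then 1 else 0)
  E_one : E 1 = 1
  E_W_mul : ∀ i j f, E (W i j * f) = (N : ℝ)⁻¹ * E (D i j f)

namespace GOEModel
variable {N : ℕ} {𝒜 : Type*} [CommRing 𝒜] [Algebra ℝ 𝒜] (M : GOEModel N 𝒜) (u : Fin N → ℝ)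

theorem isSymm_pow (k : ℕ) : (M.W ^ k).IsSymm := M.isSymm.pow k

theorem pow_apply_comm (k : ℕ) (i j : Fin N) : (M.W ^ k) i j = (M.W ^ k) j i :=
  (M.isSymm_pow k).apply j i

theorem pow_mul_pow_apply (k l : ℕ) (i j : Fin N) :
    ∑ a, (M.W ^ k) i a * (M.W ^ l) a j = (M.W ^ (k + l)) i j := by
  rw [pow_add, Matrix.mul_apply]

theorem D_pow (i j : Fin N) (k : ℕ) (a b : Fin N) :
    M.D i j ((M.W ^ k) a b) = ∑ l ∈ Finset.range k,
      ((M.W ^ l) a i * (M.W ^ (k - 1 - l)) j b + (M.W ^ l) a j * (M.W ^ (k - 1 - l)) i b) := by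
  induction k generalizing a b with
  | zero =>
    rw [pow_zero, Matrix.one_apply]
    split_ifs <;> simp
  | succ k ih =>
    rw [pow_succ', Matrix.mul_apply, map_sum, Finset.sum_range_succ']
    simp only [Derivation.leibniz, smul_eq_mul, ih, M.D_W]
    rw [Finset.sum_add_distrib]
    congr 1
    · simp only [Finset.mul_sum]
      rw [Finset.sum_comm]
      refine Finset.sum_congr rfl fun l _ => ?_
      have e : k + 1 - 1 - (l + 1) = k - 1 - l := by omega
      simp only [mul_add, Finset.sum_add_distrib, ← mul_assoc, ← Finset.sum_mul, e]
      rw [pow_succ', Matrix.mul_apply, Matrix.mul_apply]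
    · simp only [pow_zero, Matrix.one_apply, Nat.add_sub_cancel, Nat.sub_zero, mul_add,
        Finset.sum_add_distrib]
      congr 1
      · rw [Finset.sum_eq_single j]
        · simp [mul_comm]
        · intro c _ hc; simp [hc]
        · simp
      · rw [Finset.sum_eq_single i]
        · simp [mul_comm]
        · intro c _ hc; simp [hc]
        · simp

/-- The vector `W ^ k u`. -/
def powVec (k : ℕ) (i : Fin N) : 𝒜 := ∑ j, (M.W ^ k) i j * algebraMap ℝ 𝒜 (u j)

theorem powVec_zero (i : Fin N) : M.powVec u 0 i = algebraMap ℝ 𝒜 (u i) := by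
  simp [powVec, Matrix.one_apply]

theorem pow_mul_powVec (k l : ℕ) (i : Fin N) :
    ∑ j, (M.W ^ k) i j * M.powVec u l j = M.powVec u (k + l) i := by
  simp only [powVec, Finset.mul_sum]
  rw [Finset.sum_comm]
  refine Finset.sum_congr rfl fun b _ => ?_
  rw [← M.pow_mul_pow_apply, Finset.sum_mul]
  refine Finset.sum_congr rfl fun a _ => ?_
  ring

/-- The random variables `tr (W ^ k) / N` (for the tag `false`) and `⟨u, W ^ k u⟩` (for the tag
`true`). -/
noncomputable def moment : Bool → ℕ → 𝒜
  | false, k => (N : ℝ)⁻¹ • ∑ i, (M.W ^ k) i i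
  | true, k => ∑ i, algebraMap ℝ 𝒜 (u i) * M.powVec u k i

theorem powVec_mul_powVec (k l : ℕ) :
    ∑ i, M.powVec u k i * M.powVec u l i = M.moment u true (k + l) := by
  rw [moment]
  simp only [← M.pow_mul_powVec u k l, Finset.mul_sum]
  rw [Finset.sum_comm]
  refine Finset.sum_congr rfl fun i _ => ?_
  rw [powVec, Finset.sum_mul]
  refine Finset.sum_congr rfl fun j _ => ?_
  rw [M.pow_apply_comm k i j]
  ring

theorem D_powVec (i j : Fin N) (k : ℕ) (a : Fin N) :
    M.D i j (M.powVec u k a) = ∑ l ∈ Finset.range k,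
      ((M.W ^ l) a i * M.powVec u (k - 1 - l) j + (M.W ^ l) a j * M.powVec u (k - 1 - l) i) := by
  simp only [powVec, map_sum, Derivation.leibniz, Derivation.map_algebraMap, smul_eq_mul, mul_zero,
    zero_add,
    D_pow, Finset.mul_sum]
  rw [Finset.sum_comm]
  refine Finset.sum_congr rfl fun l _ => ?_
  rw [← Finset.sum_add_distrib]
  refine Finset.sum_congr rfl fun b _ => ?_
  ring

theorem D_moment_false (i j : Fin N) (m : ℕ) :
    M.D i j (M.moment u false m) = (2 * m * (N : ℝ)⁻¹) • (M.W ^ (m - 1)) i j := by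
  simp only [moment, Derivation.map_smul, map_sum, D_pow]
  rw [Finset.sum_comm]
  have : ∀ l ∈ Finset.range m, ∑ a, ((M.W ^ l) a i * (M.W ^ (m - 1 - l)) j a +
      (M.W ^ l) a j * (M.W ^ (m - 1 - l)) i a) = (2 : ℝ) • (M.W ^ (m - 1)) i j := by
    intro l hl
    have hl' : m - 1 - l + l = m - 1 := by have := Finset.mem_range.1 hl; omega
    simp only [Finset.sum_add_distrib, mul_comm ((M.W ^ l) _ _), M.pow_mul_pow_apply, hl']
    rw [M.pow_apply_comm (m - 1) j i, two_smul]
  rw [Finset.sum_congr rfl this, Finset.sum_const, Finset.card_range, ← Nat.cast_smul_eq_nsmul ℝ,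
    smul_smul, smul_smul]
  congr 1
  ring

theorem D_moment_true (i j : Fin N) (m : ℕ) :
    M.D i j (M.moment u true m) = ∑ l ∈ Finset.range m,
      (M.powVec u l i * M.powVec u (m - 1 - l) j + M.powVec u l j * M.powVec u (m - 1 - l) i) := by
  simp only [moment, map_sum, Derivation.leibniz, Derivation.map_algebraMap, smul_eq_mul, mul_zero,
    add_zero,
    D_powVec, Finset.mul_sum]
  rw [Finset.sum_comm]
  refine Finset.sum_congr rfl fun l _ => ?_
  have hp : ∀ i, M.powVec u l i = ∑ j, (M.W ^ l) i j * algebraMap ℝ 𝒜 (u j) := fun _ => rfl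
  rw [hp i, hp j, Finset.sum_mul, Finset.sum_mul, ← Finset.sum_add_distrib]
  refine Finset.sum_congr rfl fun a _ => ?_
  rw [M.pow_apply_comm l a i, M.pow_apply_comm l a j]
  ring

/-- The matrix `V` with `∑ W i j * V i j = moment b (k + 1)`. -/
noncomputable def momentCoeff : Bool → ℕ → Fin N → Fin N → 𝒜
  | false, k => fun i j => (N : ℝ)⁻¹ • (M.W ^ k) j i
  | true, k => fun i j => algebraMap ℝ 𝒜 (u i) * M.powVec u k j

theorem sum_W_mul_momentCoeff (b : Bool) (k : ℕ) :
    ∑ i, ∑ j, M.W i j * M.momentCoeff u b k i j = M.moment u b (k + 1) := by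
  have h1 : ∀ i, M.W i = (M.W ^ 1) i := fun i => by rw [pow_one]
  cases b
  · simp only [momentCoeff, moment, mul_smul_comm, ← Finset.smul_sum, h1, M.pow_mul_pow_apply,
      add_comm]
  · simp only [momentCoeff, moment, h1]
    refine Finset.sum_congr rfl fun i _ => ?_
    rw [add_comm, ← M.pow_mul_powVec, Finset.mul_sum]
    refine Finset.sum_congr rfl fun j _ => ?_
    ring

theorem sum_pow_mul_pow (k l : ℕ) :
    ∑ i, ∑ j, (M.W ^ k) j i * (M.W ^ l) j i = ∑ i, (M.W ^ (k + l)) i i := by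
  refine Finset.sum_congr rfl fun i _ => ?_
  rw [← M.pow_mul_pow_apply]
  refine Finset.sum_congr rfl fun j _ => ?_
  rw [M.pow_apply_comm k j i]

theorem sum_D_momentCoeff (b : Bool) (k : ℕ) :
    (N : ℝ)⁻¹ • ∑ i, ∑ j, M.D i j (M.momentCoeff u b k i j) =
      ∑ l ∈ Finset.range k, M.moment u false l * M.moment u b (k - 1 - l) +
        (k * (N : ℝ)⁻¹) • M.moment u b (k - 1) := by
  have hk : ∀ l ∈ Finset.range k, l + (k - 1 - l) = k - 1 := fun l hl => by
    have := Finset.mem_range.1 hl; omega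
  have hconst : ((k : ℝ) * (N : ℝ)⁻¹) • M.moment u b (k - 1) =
      ∑ _l ∈ Finset.range k, (N : ℝ)⁻¹ • M.moment u b (k - 1) := by
    rw [Finset.sum_const, Finset.card_range, ← Nat.cast_smul_eq_nsmul ℝ, smul_smul]
  rw [hconst, ← Finset.sum_add_distrib]
  cases b
  · simp only [momentCoeff, Derivation.map_smul, D_pow, ← Finset.smul_sum]
    have e : ∑ i, ∑ j, ∑ l ∈ Finset.range k, ((M.W ^ l) j i * (M.W ^ (k - 1 - l)) j i +
        (M.W ^ l) j j * (M.W ^ (k - 1 - l)) i i) = ∑ l ∈ Finset.range k,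
        (∑ i, (M.W ^ (k - 1)) i i +
          (∑ i, (M.W ^ l) i i) * ∑ i, (M.W ^ (k - 1 - l)) i i) := by
      rw [Finset.sum_congr rfl fun i _ => Finset.sum_comm, Finset.sum_comm]
      refine Finset.sum_congr rfl fun l hl => ?_
      simp only [Finset.sum_add_distrib]
      rw [M.sum_pow_mul_pow, hk l hl, Finset.sum_mul_sum, Finset.sum_comm (f := fun i j =>
        (M.W ^ l) j j * (M.W ^ (k - 1 - l)) i i)]
    rw [e, Finset.smul_sum, Finset.smul_sum]
    refine Finset.sum_congr rfl fun l _ => ?_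
    simp only [moment, smul_add, smul_mul_assoc, mul_smul_comm, smul_smul]
    rw [add_comm]
  · simp only [momentCoeff, Derivation.leibniz, Derivation.map_algebraMap, smul_eq_mul, mul_zero,
    add_zero,
      D_powVec, Finset.mul_sum]
    rw [Finset.sum_congr rfl fun i _ => Finset.sum_comm, Finset.sum_comm, Finset.smul_sum]
    refine Finset.sum_congr rfl fun l hl => ?_
    have e1 : ∑ i, ∑ j, algebraMap ℝ 𝒜 (u i) * ((M.W ^ l) j i * M.powVec u (k - 1 - l) j) =
        M.moment u true (k - 1) := by
      have hk' : M.moment u true (k - 1) = ∑ j, M.powVec u l j * M.powVec u (k - 1 - l) j := by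
        rw [powVec_mul_powVec, hk l hl]
      have hp : ∀ j, M.powVec u l j = ∑ i, (M.W ^ l) j i * algebraMap ℝ 𝒜 (u i) := fun _ => rfl
      rw [Finset.sum_comm, hk']
      refine Finset.sum_congr rfl fun j _ => ?_
      rw [hp, Finset.sum_mul]
      refine Finset.sum_congr rfl fun i _ => ?_
      ring
    have e2 : ∑ i, ∑ j, algebraMap ℝ 𝒜 (u i) * ((M.W ^ l) j j * M.powVec u (k - 1 - l) i) =
        (∑ j, (M.W ^ l) j j) * M.moment u true (k - 1 - l) := by
      rw [moment, Finset.sum_mul_sum, Finset.sum_comm]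
      refine Finset.sum_congr rfl fun j _ => Finset.sum_congr rfl fun i _ => ?_
      ring
    simp only [mul_add, Finset.sum_add_distrib, e1, e2, smul_add]
    rw [add_comm, moment, smul_mul_assoc]

/-- The contraction of `moment b (k + 1)` with `moment b' m`: the covariance-weighted product of
their gradients. -/
noncomputable def contraction (b : Bool) (k : ℕ) (f : 𝒜) : 𝒜 :=
  (N : ℝ)⁻¹ • ∑ i, ∑ j, M.momentCoeff u b k i j * M.D i j f

theorem contraction_moment_false (b : Bool) (k m : ℕ) :
    M.contraction u b k (M.moment u false m) =
      (2 * m * (N : ℝ)⁻¹ * (N : ℝ)⁻¹) • M.moment u b (k + (m - 1)) := by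
  simp only [contraction, D_moment_false, mul_smul_comm, ← Finset.smul_sum, smul_smul]
  cases b
  · have e : ∑ i, ∑ j, M.momentCoeff u false k i j * (M.W ^ (m - 1)) i j =
        M.moment u false (k + (m - 1)) := by
      simp only [momentCoeff, moment, smul_mul_assoc, ← Finset.smul_sum]
      rw [← M.sum_pow_mul_pow]
      congr 1
      refine Finset.sum_congr rfl fun i _ => Finset.sum_congr rfl fun j _ => ?_
      rw [M.pow_apply_comm (m - 1) i j]
    rw [e]
    congr 1; ring
  · have e : ∑ i, ∑ j, M.momentCoeff u true k i j * (M.W ^ (m - 1)) i j =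
        M.moment u true (k + (m - 1)) := by
      rw [add_comm, moment]
      refine Finset.sum_congr rfl fun i _ => ?_
      rw [← M.pow_mul_powVec, Finset.mul_sum]
      refine Finset.sum_congr rfl fun j _ => ?_
      simp only [momentCoeff]
      ring
    rw [e]
    congr 1; ring

theorem contraction_false_moment_true (k m : ℕ) :
    M.contraction u false k (M.moment u true m) =
      (2 * m * (N : ℝ)⁻¹ * (N : ℝ)⁻¹) • M.moment u true (k + (m - 1)) := by
  have h : ∀ l l', ∑ i, ∑ j, (M.W ^ k) j i * (M.powVec u l i * M.powVec u l' j) =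
      M.moment u true (l' + (k + l)) := by
    intro l l'
    rw [Finset.sum_comm, ← M.powVec_mul_powVec]
    refine Finset.sum_congr rfl fun j _ => ?_
    rw [← M.pow_mul_powVec, Finset.mul_sum]
    refine Finset.sum_congr rfl fun i _ => ?_
    ring
  simp only [contraction, D_moment_true, momentCoeff, smul_mul_assoc, ← Finset.smul_sum, smul_smul,
    Finset.mul_sum]
  rw [Finset.sum_congr rfl fun i _ => Finset.sum_comm, Finset.sum_comm]
  have e : ∀ l ∈ Finset.range m, ∑ i, ∑ j, (M.W ^ k) j i * (M.powVec u l i *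
      M.powVec u (m - 1 - l) j + M.powVec u l j * M.powVec u (m - 1 - l) i) =
      (2 : ℝ) • M.moment u true (k + (m - 1)) := by
    intro l hl
    have hl' := Finset.mem_range.1 hl
    simp only [mul_add, Finset.sum_add_distrib]
    simp only [mul_comm (M.powVec u l _) (M.powVec u (m - 1 - l) _)]
    rw [h (m - 1 - l) l]
    simp only [mul_comm (M.powVec u (m - 1 - l) _) (M.powVec u l _)]
    rw [h, two_smul]
    congr 2 <;> omega
  rw [Finset.sum_congr rfl e, Finset.sum_const, Finset.card_range, ← Nat.cast_smul_eq_nsmul ℝ,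
    smul_smul, smul_smul]
  congr 1
  ring

theorem contraction_true_moment_true (k m : ℕ) :
    M.contraction u true k (M.moment u true m) =
      (N : ℝ)⁻¹ • ∑ l ∈ Finset.range m,
        (M.moment u true l * M.moment u true (k + (m - 1 - l)) +
          M.moment u true (k + l) * M.moment u true (m - 1 - l)) := by
  have h : ∀ l l', ∑ i, ∑ j, algebraMap ℝ 𝒜 (u i) * M.powVec u k j *
      (M.powVec u l i * M.powVec u l' j) =
      M.moment u true l * M.moment u true (k + l') := by
    intro l l'
    rw [← M.powVec_mul_powVec, moment, Finset.sum_mul_sum]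
    refine Finset.sum_congr rfl fun i _ => Finset.sum_congr rfl fun j _ => ?_
    ring
  simp only [contraction, D_moment_true, momentCoeff, Finset.mul_sum]
  rw [Finset.sum_congr rfl fun i _ => Finset.sum_comm, Finset.sum_comm]
  congr 1
  refine Finset.sum_congr rfl fun l _ => ?_
  simp only [mul_add, Finset.sum_add_distrib]
  rw [h]
  simp only [mul_comm (M.powVec u l _) (M.powVec u (m - 1 - l) _)]
  rw [h]
  ring

/-- The Schwinger–Dyson equation. -/
theorem E_moment_succ_mul (b : Bool) (k : ℕ) (f : 𝒜) :
    M.E (M.moment u b (k + 1) * f) =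
      M.E ((∑ l ∈ Finset.range k, M.moment u false l * M.moment u b (k - 1 - l)) * f) +
        k * (N : ℝ)⁻¹ * M.E (M.moment u b (k - 1) * f) + M.E (M.contraction u b k f) := by
  have h1 : M.E (M.moment u b (k + 1) * f) =
      M.E (((N : ℝ)⁻¹ • ∑ i, ∑ j, M.D i j (M.momentCoeff u b k i j)) * f +
        M.contraction u b k f) := by
    rw [← sum_W_mul_momentCoeff, Finset.sum_mul, map_sum, contraction, smul_mul_assoc, ← smul_add,
      map_smul, Finset.sum_mul, ← Finset.sum_add_distrib, map_sum, Finset.smul_sum]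
    refine Finset.sum_congr rfl fun i _ => ?_
    rw [Finset.sum_mul, map_sum, Finset.sum_mul, ← Finset.sum_add_distrib, map_sum,
      Finset.smul_sum]
    refine Finset.sum_congr rfl fun j _ => ?_
    rw [mul_assoc, M.E_W_mul, Derivation.leibniz, smul_eq_mul, smul_eq_mul, smul_eq_mul, add_comm,
      mul_comm f]
  rw [h1, sum_D_momentCoeff, map_add, add_mul, map_add, smul_mul_assoc, map_smul, smul_eq_mul]

end GOEModel

/-! ### Boundedness of the mixed moments of the fluctuations -/

/-- The moments of the semicircle distribution on `[-2, 2]`. -/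
noncomputable def semicircleMoment : ℕ → ℝ
  | 0 => 1
  | k + 1 => ∑ l : Fin k, semicircleMoment l * semicircleMoment (k - 1 - l)
decreasing_by all_goals omega

theorem semicircleMoment_zero : semicircleMoment 0 = 1 := by rw [semicircleMoment]

theorem semicircleMoment_succ (k : ℕ) : semicircleMoment (k + 1) =
    ∑ l ∈ Finset.range k, semicircleMoment l * semicircleMoment (k - 1 - l) := by
  rw [semicircleMoment,
    Finset.sum_range fun l => semicircleMoment l * semicircleMoment (k - 1 - l)]

namespace GOEModel

section
variable {N : ℕ} {𝒜 : Type*} [CommRing 𝒜] [Algebra ℝ 𝒜] (M : GOEModel N 𝒜) (u : Fin N → ℝ)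

/-- The rescaled deviation of a moment from its limit. -/
noncomputable def fluct (a : Bool × ℕ) : 𝒜 :=
  √(N : ℝ) • (M.moment u a.1 a.2 - algebraMap ℝ 𝒜 (semicircleMoment a.2))

theorem moment_zero (hN : 1 ≤ N) (hu : ∑ i, u i ^ 2 = 1) (b : Bool) : M.moment u b 0 = 1 := by
  have hN' : (N : ℝ) ≠ 0 := by positivity
  cases b
  · simp only [moment, pow_zero, Matrix.one_apply_eq, Finset.sum_const, Finset.card_univ,
      Fintype.card_fin]
    rw [← Nat.cast_smul_eq_nsmul ℝ, smul_smul, inv_mul_cancel₀ hN', one_smul]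
  · simp only [moment, powVec_zero, ← map_mul, ← map_sum]
    rw [← map_one (algebraMap ℝ 𝒜), ← hu]
    simp only [sq]

theorem moment_eq (hN : 1 ≤ N) (a : Bool × ℕ) : M.moment u a.1 a.2 =
    algebraMap ℝ 𝒜 (semicircleMoment a.2) + (√(N : ℝ))⁻¹ • M.fluct u a := by
  have hN' : √(N : ℝ) ≠ 0 := by positivity
  rw [fluct, smul_smul, inv_mul_cancel₀ hN', one_smul]
  ring

theorem contraction_mul (b : Bool) (k : ℕ) (f g : 𝒜) : M.contraction u b k (f * g) =
    f * M.contraction u b k g + g * M.contraction u b k f := by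
  simp only [contraction, Derivation.leibniz, smul_eq_mul, mul_smul_comm, ← smul_add,
    Finset.mul_sum, ← Finset.sum_add_distrib]
  congr 1
  refine Finset.sum_congr rfl fun i _ => Finset.sum_congr rfl fun j _ => ?_
  ring

theorem contraction_one (b : Bool) (k : ℕ) : M.contraction u b k 1 = 0 := by
  simp [contraction]

theorem contraction_fluct (b : Bool) (k : ℕ) (a : Bool × ℕ) : M.contraction u b k (M.fluct u a) =
    √(N : ℝ) • M.contraction u b k (M.moment u a.1 a.2) := by
  simp only [contraction, fluct, Derivation.map_smul, map_sub, Derivation.map_algebraMap,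
    sub_zero, mul_smul_comm, ← Finset.smul_sum]
  rw [smul_comm]

end

section
variable {𝒜 : ℕ → Type*} [∀ N, CommRing (𝒜 N)] [∀ N, Algebra ℝ (𝒜 N)]
  (M : ∀ N, GOEModel N (𝒜 N)) (u : ∀ N, Fin N → ℝ)

/-- The total degree in `W` of a product of moments. -/
def weight (L : List (Bool × ℕ)) : ℕ := (L.map Prod.snd).sum

/-- Sequences of random variables which, for `1 ≤ N`, are finite linear combinations of products of
fluctuations of total degree at most `d`, with coefficients that are bounded in `N`. -/
inductive IsFluctPoly (d : ℕ) : (∀ N, 𝒜 N) → Prop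
  | prod (L : List (Bool × ℕ)) (h : weight L ≤ d) :
      IsFluctPoly d fun N => (L.map ((M N).fluct (u N))).prod
  | zero : IsFluctPoly d fun _ => 0
  | add {P Q : ∀ N, 𝒜 N} (hP : IsFluctPoly d P) (hQ : IsFluctPoly d Q) :
      IsFluctPoly d fun N => P N + Q N
  | smul {P : ∀ N, 𝒜 N} (c : ℕ → ℝ) (K : ℝ) (hc : ∀ N, |c N| ≤ K) (hP : IsFluctPoly d P) :
      IsFluctPoly d fun N => c N • P N
  | congr {P Q : ∀ N, 𝒜 N} (h : ∀ N, 1 ≤ N → P N = Q N) (hP : IsFluctPoly d P) :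
      IsFluctPoly d Q

variable {M u}

namespace IsFluctPoly

theorem mono {d e : ℕ} (hde : d ≤ e) {P : ∀ N, 𝒜 N} (hP : IsFluctPoly M u d P) :
    IsFluctPoly M u e P := by
  induction hP with
  | prod L h => exact .prod L (h.trans hde)
  | zero => exact .zero
  | add _ _ h1 h2 => exact .add h1 h2
  | smul c K hc _ h => exact .smul c K hc h
  | congr h _ h1 => exact .congr h h1

theorem mul {d e : ℕ} {P Q : ∀ N, 𝒜 N} (hP : IsFluctPoly M u d P) (hQ : IsFluctPoly M u e Q) :
    IsFluctPoly M u (d + e) fun N => P N * Q N := by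
  induction hP with
  | prod L h =>
    induction hQ with
    | prod L' h' =>
      refine .congr (fun N _ => ?_) (.prod (L ++ L') ?_)
      · rw [List.map_append, List.prod_append]
      · simp only [weight, List.map_append, List.sum_append] at h h' ⊢
        omega
    | zero => exact .congr (fun N _ => (mul_zero _).symm) .zero
    | add _ _ h1 h2 => exact .congr (fun N _ => (mul_add _ _ _).symm) (.add h1 h2)
    | smul c K hc _ h1 => exact .congr (fun N _ => (mul_smul_comm _ _ _).symm) (.smul c K hc h1)
    | congr h _ h1 => exact .congr (fun N hN => by rw [h N hN]) h1
  | zero => exact .congr (fun N _ => (zero_mul _).symm) .zero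
  | add _ _ h1 h2 => exact .congr (fun N _ => (add_mul _ _ _).symm) (.add h1 h2)
  | smul c K hc _ h1 => exact .congr (fun N _ => (smul_mul_assoc _ _ _).symm) (.smul c K hc h1)
  | congr h _ h1 => exact .congr (fun N hN => by rw [h N hN]) h1

theorem one : IsFluctPoly M u 0 fun _ => 1 :=
  .congr (fun N _ => by simp) (.prod [] (by simp [weight]))

theorem const_smul {d : ℕ} {P : ∀ N, 𝒜 N} (c : ℝ) (hP : IsFluctPoly M u d P) :
    IsFluctPoly M u d fun N => c • P N := .smul (fun _ => c) |c| (fun _ => le_rfl) hP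

theorem sum {ι : Type*} (s : Finset ι) {d : ℕ} {P : ι → ∀ N, 𝒜 N}
    (hP : ∀ i ∈ s, IsFluctPoly M u d (P i)) : IsFluctPoly M u d fun N => ∑ i ∈ s, P i N := by
  classical
  induction s using Finset.induction_on with
  | empty => exact .congr (fun N _ => by simp) .zero
  | insert a s ha ih =>
    refine .congr (fun N _ => (Finset.sum_insert ha).symm)
      (.add (hP a (Finset.mem_insert_self a s)) (ih fun i hi => hP i (Finset.mem_insert_of_mem hi)))

theorem fluct (a : Bool × ℕ) : IsFluctPoly M u a.2 fun N => (M N).fluct (u N) a :=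
  .congr (fun N _ => by simp) (.prod [a] (by simp [weight]))

theorem abs_inv_natCast_le (N : ℕ) : |(N : ℝ)⁻¹| ≤ 1 := by
  rcases Nat.eq_zero_or_pos N with h | h
  · simp [h]
  · rw [abs_of_nonneg (by positivity)]
    exact inv_le_one_of_one_le₀ (by exact_mod_cast h)

theorem abs_inv_sqrt_natCast_le (N : ℕ) : |(√(N : ℝ))⁻¹| ≤ 1 := by
  rcases Nat.eq_zero_or_pos N with h | h
  · simp [h]
  · rw [abs_of_nonneg (by positivity)]
    exact inv_le_one_of_one_le₀ (Real.one_le_sqrt.2 (by exact_mod_cast h))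

theorem moment (b : Bool) (k : ℕ) : IsFluctPoly M u k fun N => (M N).moment (u N) b k := by
  refine .congr (fun N hN => ((M N).moment_eq (u N) hN (b, k)).symm) (.add ?_ ?_)
  · exact .congr (fun N _ => (Algebra.algebraMap_eq_smul_one _).symm)
      ((one.const_smul (semicircleMoment k)).mono (Nat.zero_le k))
  · exact .smul _ 1 abs_inv_sqrt_natCast_le (fluct (b, k))

theorem contraction_moment (b : Bool) (k : ℕ) (a : Bool × ℕ) : IsFluctPoly M u (k + a.2) fun N =>
    (N : ℝ) • (M N).contraction (u N) b k ((M N).moment (u N) a.1 a.2) := by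
  obtain ⟨b', m⟩ := a
  have h1 : ∀ b'', IsFluctPoly M u (k + m) fun N =>
      (N : ℝ) • (2 * m * (N : ℝ)⁻¹ * (N : ℝ)⁻¹) • (M N).moment (u N) b'' (k + (m - 1)) := by
    intro b''
    refine .congr (fun N hN => ?_) (((IsFluctPoly.smul _ 1 abs_inv_natCast_le
      (moment b'' (k + (m - 1)))).const_smul (2 * m)).mono (by omega))
    have hN' : (N : ℝ) ≠ 0 := by positivity
    rw [smul_smul, smul_smul]
    congr 1
    field_simp
  cases b'
  · simpa only [contraction_moment_false] using h1 b
  cases b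
  · simpa only [contraction_false_moment_true] using h1 true
  refine .congr (P := fun N => ∑ l ∈ Finset.range m,
        ((M N).moment (u N) true l * (M N).moment (u N) true (k + (m - 1 - l)) +
          (M N).moment (u N) true (k + l) * (M N).moment (u N) true (m - 1 - l)))
    (fun N hN => ?_) (sum _ fun l hl => ?_)
  · have hN' : (N : ℝ) ≠ 0 := by positivity
    rw [contraction_true_moment_true, smul_smul, mul_inv_cancel₀ hN', one_smul]
  · have hl' := Finset.mem_range.1 hl
    refine .add ?_ ?_
    · exact ((moment true l).mul (moment true (k + (m - 1 - l)))).mono (by dsimp only; omega)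
    · exact ((moment true (k + l)).mul (moment true (m - 1 - l))).mono (by dsimp only; omega)

theorem contraction_prod (b : Bool) (k : ℕ) (L : List (Bool × ℕ)) :
    IsFluctPoly M u (k + weight L) fun N =>
      √(N : ℝ) • (M N).contraction (u N) b k (L.map ((M N).fluct (u N))).prod := by
  induction L with
  | nil => exact .congr (fun N _ => by simp [contraction_one]) .zero
  | cons a L ih =>
    have hw : weight (a :: L) = a.2 + weight L := by simp [weight]
    have h1 : IsFluctPoly M u (a.2 + (k + weight L)) _ := (fluct a).mul ih
    have h2 : IsFluctPoly M u (weight L + (k + a.2)) _ :=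
      (IsFluctPoly.prod L le_rfl).mul (contraction_moment b k a)
    refine .congr (fun N _ => ?_) ((h1.mono (by omega)).add (h2.mono (by omega)))
    rw [List.map_cons, List.prod_cons, contraction_mul, contraction_fluct, mul_smul_comm,
      mul_smul_comm, mul_smul_comm, smul_add, smul_smul, Real.mul_self_sqrt (Nat.cast_nonneg N)]

theorem exists_abs_E_le {d : ℕ}
    (h : ∀ L, weight L ≤ d → ∃ C : ℝ, ∀ N, 1 ≤ N →
      |(M N).E (L.map ((M N).fluct (u N))).prod| ≤ C)
    {P : ∀ N, 𝒜 N} (hP : IsFluctPoly M u d P) : ∃ C : ℝ, ∀ N, 1 ≤ N → |(M N).E (P N)| ≤ C := by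
  induction hP with
  | prod L hL => exact h L hL
  | zero => exact ⟨0, fun N _ => by simp⟩
  | add _ _ h1 h2 =>
    obtain ⟨C1, h1⟩ := h1
    obtain ⟨C2, h2⟩ := h2
    refine ⟨C1 + C2, fun N hN => ?_⟩
    rw [map_add]
    exact (abs_add_le _ _).trans (add_le_add (h1 N hN) (h2 N hN))
  | smul c K hc _ h1 =>
    obtain ⟨C1, h1⟩ := h1
    refine ⟨K * C1, fun N hN => ?_⟩
    rw [map_smul, smul_eq_mul, abs_mul]
    exact mul_le_mul (hc N) (h1 N hN) (abs_nonneg _) ((abs_nonneg _).trans (hc N))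
  | congr hPQ _ h1 =>
    obtain ⟨C1, h1⟩ := h1
    exact ⟨C1, fun N hN => by rw [← hPQ N hN]; exact h1 N hN⟩

end IsFluctPoly

/-- By the Schwinger–Dyson equation, a product of fluctuations whose first factor has degree `k + 1`
has the same expectation as a combination of products of smaller total degree: the powers of `√N`
balance because the limits `semicircleMoment` solve the limiting equation. -/
theorem exists_isFluctPoly_E_eq (b : Bool) (k : ℕ) (L : List (Bool × ℕ)) :
    ∃ P, IsFluctPoly M u (k + weight L) P ∧ ∀ N, 1 ≤ N →
      (M N).E ((M N).fluct (u N) (b, k + 1) * (L.map ((M N).fluct (u N))).prod) =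
        (M N).E (P N) := by
  have hq : ∀ l ∈ Finset.range k, IsFluctPoly M u k fun N =>
      √(N : ℝ) • ((M N).moment (u N) false l * (M N).moment (u N) b (k - 1 - l) -
        algebraMap ℝ (𝒜 N) (semicircleMoment l * semicircleMoment (k - 1 - l))) := by
    intro l hl
    have hl' := Finset.mem_range.1 hl
    have h1 := (IsFluctPoly.fluct (M := M) (u := u) (b, k - 1 - l)).const_smul (semicircleMoment l)
    have h2 := (IsFluctPoly.fluct (M := M) (u := u) (false, l)).const_smul
      (semicircleMoment (k - 1 - l))
    have h3 := IsFluctPoly.smul _ 1 IsFluctPoly.abs_inv_sqrt_natCast_le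
      ((IsFluctPoly.fluct (M := M) (u := u) (false, l)).mul
        (IsFluctPoly.fluct (M := M) (u := u) (b, k - 1 - l)))
    dsimp only at h1 h2 h3
    refine .congr (fun N hN => ?_) (((h1.mono (e := k) (by omega)).add
      (h2.mono (e := k) (by omega))).add (h3.mono (e := k) (by omega)))
    have hN' : √(N : ℝ) ≠ 0 := by positivity
    have e1 := (M N).moment_eq (u N) hN (false, l)
    have e2 := (M N).moment_eq (u N) hN (b, k - 1 - l)
    dsimp only at e1 e2
    have e3 : algebraMap ℝ (𝒜 N) (√(N : ℝ)) * algebraMap ℝ (𝒜 N) (√(N : ℝ))⁻¹ = 1 := by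
      rw [← map_mul, mul_inv_cancel₀ hN', map_one]
    rw [e1, e2]
    simp only [Algebra.smul_def, map_mul]
    linear_combination (-(algebraMap ℝ (𝒜 N) (semicircleMoment l)) *
      (M N).fluct (u N) (b, k - 1 - l) - algebraMap ℝ (𝒜 N) (semicircleMoment (k - 1 - l)) *
      (M N).fluct (u N) (false, l) - algebraMap ℝ (𝒜 N) (√(N : ℝ))⁻¹ *
      (M N).fluct (u N) (false, l) * (M N).fluct (u N) (b, k - 1 - l)) * e3
  have hL : IsFluctPoly M u (weight L) _ := .prod L le_rfl
  have hm := (IsFluctPoly.smul _ 1 IsFluctPoly.abs_inv_sqrt_natCast_le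
    ((IsFluctPoly.moment (M := M) (u := u) b (k - 1)).mul hL)).const_smul k
  refine ⟨_, (((IsFluctPoly.sum _ hq).mul hL).add (hm.mono (by omega))).add
    (IsFluctPoly.contraction_prod b k L), fun N hN => ?_⟩
  have hN' : √(N : ℝ) ≠ 0 := by positivity
  have hsq : √(N : ℝ) * (N : ℝ)⁻¹ = (√(N : ℝ))⁻¹ := by
    have : (N : ℝ) = √(N : ℝ) * √(N : ℝ) := (Real.mul_self_sqrt (Nat.cast_nonneg N)).symm
    rw [this, Real.sqrt_mul_self (Real.sqrt_nonneg _), mul_inv, mul_inv_cancel_left₀ hN']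
  set R := (L.map ((M N).fluct (u N))).prod
  have e := (M N).E_moment_succ_mul (u N) b k R
  have hc : (M N).E (algebraMap ℝ (𝒜 N) (semicircleMoment (k + 1)) * R) =
      ∑ l ∈ Finset.range k, semicircleMoment l * semicircleMoment (k - 1 - l) * (M N).E R := by
    rw [← Algebra.smul_def, map_smul, smul_eq_mul, semicircleMoment_succ, Finset.sum_mul]
  have hterm : (M N).E ((∑ l ∈ Finset.range k, √(N : ℝ) •
      ((M N).moment (u N) false l * (M N).moment (u N) b (k - 1 - l) -
        algebraMap ℝ (𝒜 N) (semicircleMoment l * semicircleMoment (k - 1 - l)))) * R) =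
      √(N : ℝ) * ((M N).E ((∑ l ∈ Finset.range k, (M N).moment (u N) false l *
        (M N).moment (u N) b (k - 1 - l)) * R) -
      ∑ l ∈ Finset.range k, semicircleMoment l * semicircleMoment (k - 1 - l) * (M N).E R) := by
    rw [← Finset.smul_sum, smul_mul_assoc, map_smul, smul_eq_mul, Finset.sum_sub_distrib, sub_mul,
      map_sub]
    congr 2
    rw [← map_sum, ← Algebra.smul_def, map_smul, smul_eq_mul, Finset.sum_mul]
  rw [map_add, map_add, hterm, fluct, smul_mul_assoc, map_smul, smul_eq_mul, sub_mul, map_sub, hc,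
    e]
  simp only [map_smul, smul_eq_mul]
  linear_combination (k * (M N).E ((M N).moment (u N) b (k - 1) * R)) * hsq

/-- All mixed moments of the fluctuations are bounded uniformly in the dimension. -/
theorem exists_abs_E_prod_fluct_le (hu : ∀ N, 1 ≤ N → ∑ i, u N i ^ 2 = 1) (d : ℕ) :
    ∀ L, weight L ≤ d → ∃ C : ℝ, ∀ N, 1 ≤ N →
      |(M N).E (L.map ((M N).fluct (u N))).prod| ≤ C := by
  induction d using Nat.strong_induction_on with
  | _ d ih =>
    intro L hL
    match L with
    | [] => exact ⟨1, fun N _ => by simp [(M N).E_one]⟩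
    | (b, 0) :: L =>
      refine ⟨0, fun N hN => ?_⟩
      have : (M N).fluct (u N) (b, 0) = 0 := by
        rw [fluct, moment_zero _ _ hN (hu N hN), semicircleMoment_zero, map_one, sub_self,
          smul_zero]
      rw [List.map_cons, List.prod_cons, this, zero_mul, map_zero, abs_zero]
    | (b, k + 1) :: L =>
      obtain ⟨P, hP, hPE⟩ := exists_isFluctPoly_E_eq (M := M) (u := u) b k L
      have hw : weight ((b, k + 1) :: L) = k + 1 + weight L := by simp [weight]
      obtain ⟨C, hC⟩ := hP.exists_abs_E_le (ih (k + weight L) (by omega))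
      refine ⟨C, fun N hN => ?_⟩
      rw [List.map_cons, List.prod_cons, hPE N hN]
      exact hC N hN

/-- The fourth moments of `⟨u, W ^ k u⟩ - semicircleMoment k` are `O(N⁻²)`. -/
theorem exists_E_moment_sub_pow_four_le (hu : ∀ N, 1 ≤ N → ∑ i, u N i ^ 2 = 1) (k : ℕ) :
    ∃ C : ℝ, ∀ N, 1 ≤ N → (M N).E (((M N).moment (u N) true k -
      algebraMap ℝ (𝒜 N) (semicircleMoment k)) ^ 4) ≤ C / (N : ℝ) ^ 2 := by
  obtain ⟨C, hC⟩ := exists_abs_E_prod_fluct_le (M := M) hu _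
    [(true, k), (true, k), (true, k), (true, k)] le_rfl
  refine ⟨C, fun N hN => ?_⟩
  have hN' : (0 : ℝ) < N := by exact_mod_cast hN
  have h := (le_abs_self _).trans (hC N hN)
  rw [le_div_iff₀ (by positivity)]
  refine le_of_eq_of_le ?_ h
  have e4 : √(N : ℝ) ^ 4 = (N : ℝ) ^ 2 := by
    rw [show 4 = 2 * 2 from rfl, pow_mul, Real.sq_sqrt hN'.le]
  have : ([(true, k), (true, k), (true, k), (true, k)].map ((M N).fluct (u N))).prod =
      (N : ℝ) ^ 2 • ((M N).moment (u N) true k - algebraMap ℝ (𝒜 N) (semicircleMoment k)) ^ 4 := by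
    rw [← e4, ← smul_pow]
    simp only [List.map_cons, List.map_nil, List.prod_cons, List.prod_nil, fluct]
    ring
  rw [this, map_smul, smul_eq_mul, mul_comm]

end
end GOEModel

/-! ### Polynomials in independent Gaussian variables as a model of the GOE -/

theorem hasDerivAt_eval_update {κ : Type*} [DecidableEq κ] (p : κ) (f : MvPolynomial κ ℝ)
    (g : κ → ℝ) (t : ℝ) :
    HasDerivAt (fun s => MvPolynomial.eval (Function.update g p s) f)
      (MvPolynomial.eval (Function.update g p t) (MvPolynomial.pderiv p f)) t := by
  induction f using MvPolynomial.induction_on with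
  | C a => simpa using hasDerivAt_const t a
  | add f h hf hh =>
    simp only [map_add]
    exact hf.add hh
  | mul_X f q hf =>
    have hX : HasDerivAt (fun s => Function.update g p s q)
        (MvPolynomial.eval (Function.update g p t)
          (MvPolynomial.pderiv p (MvPolynomial.X q))) t := by
      by_cases h : q = p
      · subst h
        simpa using hasDerivAt_id' t
      · simpa [Function.update_of_ne h, MvPolynomial.pderiv_X_of_ne h] using
          hasDerivAt_const t (g q)
    refine ((hf.mul hX).congr_deriv ?_).congr_of_eventuallyEq (Eventually.of_forall fun s => ?_)
    · simp only [Derivation.leibniz, smul_eq_mul, map_add, map_mul, MvPolynomial.eval_X]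
      ring
    · simp

section
variable {κ : Type*} [Fintype κ]

theorem integrable_eval_gaussianPi (f : MvPolynomial κ ℝ) :
    Integrable (fun g => MvPolynomial.eval g f) (gaussianPi κ) := by
  induction f using MvPolynomial.induction_on' with
  | monomial n a =>
    simp only [MvPolynomial.eval_monomial, Finsupp.prod_fintype _ _ fun _ => pow_zero _]
    refine Integrable.const_mul (Integrable.fintype_prod (f := fun i x => x ^ n i) fun i => ?_) a
    rcases Nat.eq_zero_or_pos (n i) with h | h
    · simp [h]
    · have := (memLp_id_gaussianReal (μ := 0) (v := 1) (n i : NNReal))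
      have h2 := this.integrable_norm_pow (by omega)
      refine h2.mono (by fun_prop) (ae_of_all _ fun x => ?_)
      simp
  | add p q hp hq =>
    simp only [map_add]
    exact hp.add hq

/-- Expectation of a polynomial in independent standard Gaussian variables. -/
noncomputable def gaussianExpect (κ : Type*) [Fintype κ] : MvPolynomial κ ℝ →ₗ[ℝ] ℝ where
  toFun f := ∫ g, MvPolynomial.eval g f ∂gaussianPi κ
  map_add' f h := by
    simp only [map_add]
    exact integral_add (integrable_eval_gaussianPi f) (integrable_eval_gaussianPi h)
  map_smul' c f := by
    simp only [MvPolynomial.smul_eval, RingHom.id_apply, smul_eq_mul]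
    exact integral_const_mul _ _

theorem gaussianExpect_X_mul (p : κ) (f : MvPolynomial κ ℝ) :
    gaussianExpect κ (MvPolynomial.X p * f) = gaussianExpect κ (MvPolynomial.pderiv p f) := by
  classical
  have h := integrable_eval_gaussianPi (MvPolynomial.X p * f)
  simp only [map_mul, MvPolynomial.eval_X] at h
  simp only [gaussianExpect, LinearMap.coe_mk, AddHom.coe_mk, map_mul, MvPolynomial.eval_X]
  exact integral_coord_mul_gaussianPi p (hasDerivAt_eval_update p f)
    (integrable_eval_gaussianPi f) (integrable_eval_gaussianPi _) h

end

theorem upperIdx_eq_iff {N : ℕ} (i j k l : Fin N) :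
    upperIdx k l = upperIdx i j ↔ (k = i ∧ l = j) ∨ (k = j ∧ l = i) := by
  simp only [upperIdx, Subtype.mk.injEq, Prod.mk.injEq, Fin.ext_iff, Fin.coe_min, Fin.coe_max]
  omega

theorem natCast_mul_goeStd_mul_goeStd {N : ℕ} (i j : Fin N) :
    (N : ℝ) * goeStd i j * goeStd i j = if i = j then 2 else 1 := by
  have hN : (N : ℝ) ≠ 0 := by
    have := i.pos
    positivity
  rw [mul_assoc, goeStd]
  split_ifs
  · rw [Real.mul_self_sqrt (by positivity)]; field_simp
  · rw [Real.mul_self_sqrt (by positivity)]; field_simp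

/-- The GOE as a matrix of linear polynomials in independent standard Gaussian variables. -/
noncomputable def goeModel (N : ℕ) : GOEModel N (MvPolynomial (UpperIdx N) ℝ) where
  E := gaussianExpect (UpperIdx N)
  W := fun i j => goeStd i j • MvPolynomial.X (upperIdx i j)
  D := fun i j => ((N : ℝ) * goeStd i j) • MvPolynomial.pderiv (upperIdx i j)
  isSymm := by
    refine Matrix.IsSymm.ext fun i j => ?_
    rw [goeStd_comm, upperIdx_comm]
  D_W := by
    intro i j k l
    rw [Derivation.smul_apply, Derivation.map_smul, smul_smul, MvPolynomial.pderiv_X,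
      Pi.single_apply]
    by_cases h : upperIdx k l = upperIdx i j
    · have hs : goeStd k l = goeStd i j := by
        rcases (upperIdx_eq_iff i j k l).1 h with ⟨rfl, rfl⟩ | ⟨rfl, rfl⟩
        · rfl
        · exact goeStd_comm _ _
      rw [if_pos h, hs, natCast_mul_goeStd_mul_goeStd]
      rcases (upperIdx_eq_iff i j k l).1 h with ⟨rfl, rfl⟩ | ⟨rfl, rfl⟩
      · by_cases hkl : k = l
        · subst hkl; simp [MvPolynomial.smul_eq_C_mul, map_ofNat]; norm_num
        · simp [hkl, Ne.symm hkl]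
      · by_cases hkl : k = l
        · subst hkl; simp [MvPolynomial.smul_eq_C_mul, map_ofNat]; norm_num
        · simp [hkl, Ne.symm hkl]
    · rw [if_neg h, smul_zero]
      rw [upperIdx_eq_iff, not_or, not_and, not_and] at h
      by_cases h1 : k = i
      · have := h.1 h1
        by_cases h2 : k = j
        · simp [this, h.2 h2]
        · simp [this, h2]
      · by_cases h2 : k = j
        · simp [h1, h.2 h2]
        · simp [h1, h2]
  E_one := by simp [gaussianExpect]
  E_W_mul := by
    intro i j f
    have hN : (N : ℝ) ≠ 0 := by
      have := i.pos
      positivity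
    rw [smul_mul_assoc, map_smul, Derivation.smul_apply, map_smul, gaussianExpect_X_mul,
      smul_eq_mul, smul_eq_mul, mul_assoc, inv_mul_cancel_left₀ hN]

/-- The quadratic form `⟨u, A ^ k u⟩`. -/
noncomputable def quadPow {N : ℕ} (A : Matrix (Fin N) (Fin N) ℝ) (u : Fin N → ℝ) (k : ℕ) : ℝ :=
  u ⬝ᵥ (A ^ k).mulVec u

theorem eval_moment_goeModel {N : ℕ} (u : Fin N → ℝ) (k : ℕ) (g : UpperIdx N → ℝ) :
    MvPolynomial.eval g ((goeModel N).moment u true k) = quadPow (goeMatrix g) u k := by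
  have h1 : (MvPolynomial.eval g).mapMatrix (goeModel N).W = goeMatrix g := by
    ext i j
    rw [RingHom.mapMatrix_apply, Matrix.map_apply]
    simp [goeModel, goeMatrix]
  have h2 : ∀ i j, MvPolynomial.eval g (((goeModel N).W ^ k) i j) = (goeMatrix g ^ k) i j := by
    intro i j
    rw [← h1, ← map_pow]
    rfl
  simp only [GOEModel.moment, GOEModel.powVec, map_sum, map_mul, h2, quadPow, dotProduct,
    Matrix.mulVec,
    MvPolynomial.algebraMap_eq, MvPolynomial.eval_C]

/-- The deviations of `⟨u, W ^ k u⟩` from `semicircleMoment k` have summable probability, by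
Markov's inequality for the fourth power. -/
theorem exists_goe_quadPow_deviation_le {u : ∀ N, Fin N → ℝ}
    (hu : ∀ N, 1 ≤ N → ∑ i, u N i ^ 2 = 1) (k : ℕ) {ε : ℝ} (hε : 0 < ε) :
    ∃ b : ℕ → ℝ, Summable b ∧ ∀ N, 1 ≤ N →
      gaussianPi (UpperIdx N) {g | ε ≤ |quadPow (goeMatrix g) (u N) k - semicircleMoment k|} ≤
        ENNReal.ofReal (b N) := by
  obtain ⟨C, hC⟩ := GOEModel.exists_E_moment_sub_pow_four_le (M := goeModel) hu k
  refine ⟨fun N => C / ε ^ 4 * (1 / (N : ℝ) ^ 2),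
    (Real.summable_one_div_nat_pow.2 (by norm_num)).mul_left _, fun N hN => ?_⟩
  have h := hC N hN
  set f := ((goeModel N).moment (u N) true k -
    algebraMap ℝ (MvPolynomial (UpperIdx N) ℝ) (semicircleMoment k)) ^ 4 with hf
  have hev : ∀ g, MvPolynomial.eval g f =
      (quadPow (goeMatrix g) (u N) k - semicircleMoment k) ^ 4 := by
    intro g
    rw [hf, map_pow, map_sub, eval_moment_goeModel, MvPolynomial.algebraMap_eq,
      MvPolynomial.eval_C]
  have hE : (goeModel N).E f = ∫ g, MvPolynomial.eval g f ∂gaussianPi (UpperIdx N) := rfl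
  rw [hE] at h
  have hm := mul_meas_ge_le_integral_of_nonneg (μ := gaussianPi (UpperIdx N))
    (f := fun g => MvPolynomial.eval g f) (ae_of_all _ fun g => by
      simp only [hev, Pi.zero_apply]; positivity)
    (integrable_eval_gaussianPi f) (ε ^ 4)
  rw [← ofReal_measureReal]
  refine ENNReal.ofReal_le_ofReal ?_
  have hsub : (gaussianPi (UpperIdx N)).real
      {g | ε ≤ |quadPow (goeMatrix g) (u N) k - semicircleMoment k|} ≤
      (gaussianPi (UpperIdx N)).real {g | ε ^ 4 ≤ MvPolynomial.eval g f} := by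
    refine measureReal_mono fun g hg => ?_
    have hg' : ε ≤ |quadPow (goeMatrix g) (u N) k - semicircleMoment k| := hg
    change ε ^ 4 ≤ MvPolynomial.eval g f
    rw [hev, ← Even.pow_abs (by decide) (quadPow _ _ _ - _)]
    exact pow_le_pow_left₀ hε.le hg' 4
  refine hsub.trans ?_
  simp only [div_mul_div_comm, mul_one]
  rw [le_div_iff₀ (by positivity)]
  have hN' : (0 : ℝ) < (N : ℝ) ^ 2 := by positivity
  have h2 := hm.trans h
  rw [le_div_iff₀ hN'] at h2
  linarith

/-! ### Orthogonal polynomials of the semicircle distribution -/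

open Polynomial in
/-- The functional `X ^ k ↦ semicircleMoment k` on polynomials. -/
noncomputable def semicircle : ℝ[X] →ₗ[ℝ] ℝ :=
  Polynomial.lsum fun k => semicircleMoment k • LinearMap.id

theorem semicircle_X_pow (k : ℕ) : semicircle (Polynomial.X ^ k) = semicircleMoment k := by
  rw [semicircle, Polynomial.lsum_apply, ← Polynomial.monomial_one_right_eq_X_pow,
    Polynomial.sum_monomial_index _ _ (by simp)]
  simp

theorem semicircle_one : semicircle 1 = 1 := by
  rw [← pow_zero Polynomial.X, semicircle_X_pow, semicircleMoment_zero]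

/-- The functional `p ↦ (φ ⊗ φ) ((q ⊗ 1) * ∂p)`, where `φ` is `semicircle` and `∂p` is the
difference quotient `(p(x) - p(y)) / (x - y)`. -/
noncomputable def semicircleQuotient (q : Polynomial ℝ) : Polynomial ℝ →ₗ[ℝ] ℝ :=
  Polynomial.lsum fun k => (∑ l ∈ Finset.range k, semicircle (q * Polynomial.X ^ l) *
    semicircleMoment (k - 1 - l)) • LinearMap.id

theorem semicircleQuotient_X_pow (q : Polynomial ℝ) (k : ℕ) :
    semicircleQuotient q (Polynomial.X ^ k) = ∑ l ∈ Finset.range k,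
      semicircle (q * Polynomial.X ^ l) * semicircleMoment (k - 1 - l) := by
  rw [semicircleQuotient, Polynomial.lsum_apply, ← Polynomial.monomial_one_right_eq_X_pow,
    Polynomial.sum_monomial_index _ _ (by simp)]
  simp

theorem semicircleQuotient_one (q : Polynomial ℝ) : semicircleQuotient q 1 = 0 := by
  rw [← pow_zero Polynomial.X, semicircleQuotient_X_pow]
  simp

theorem semicircleQuotient_X_mul (q p : Polynomial ℝ) :
    semicircleQuotient q (Polynomial.X * p) =
      semicircle q * semicircle p + semicircleQuotient (q * Polynomial.X) p := by
  induction p using Polynomial.induction_on' with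
  | add p r hp hr => simp only [mul_add, map_add, hp, hr]; ring
  | monomial k a =>
    rw [← Polynomial.C_mul_X_pow_eq_monomial, Polynomial.C_mul', mul_smul_comm, map_smul, map_smul,
      map_smul, ← pow_succ', semicircleQuotient_X_pow, semicircleQuotient_X_pow, semicircle_X_pow,
      Finset.sum_range_succ']
    simp only [pow_zero, mul_one, Nat.add_sub_cancel, Nat.sub_zero, smul_eq_mul]
    have e : ∀ l, semicircle (q * Polynomial.X ^ (l + 1)) * semicircleMoment (k - (l + 1)) =
        semicircle (q * Polynomial.X * Polynomial.X ^ l) * semicircleMoment (k - 1 - l) := by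
      intro l
      rw [show k - (l + 1) = k - 1 - l by omega, pow_succ', mul_assoc]
    simp only [e]
    ring

/-- The recursion for `semicircleMoment`, as an identity between functionals on polynomials. -/
theorem semicircle_X_mul (p : Polynomial ℝ) :
    semicircle (Polynomial.X * p) = semicircleQuotient 1 p := by
  induction p using Polynomial.induction_on' with
  | add p r hp hr => simp only [mul_add, map_add, hp, hr]
  | monomial k a =>
    rw [← Polynomial.C_mul_X_pow_eq_monomial, Polynomial.C_mul', mul_smul_comm, map_smul, map_smul,
      ← pow_succ', semicircleQuotient_X_pow, semicircle_X_pow, semicircleMoment_succ]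
    simp only [one_mul, semicircle_X_pow]

/-- The Chebyshev polynomials of the second kind, rescaled to `[-2, 2]`. -/
noncomputable def chebyshev : ℕ → Polynomial ℝ
  | 0 => 1
  | 1 => Polynomial.X
  | n + 2 => Polynomial.X * chebyshev (n + 1) - chebyshev n

theorem X_mul_chebyshev_zero : Polynomial.X * chebyshev 0 = chebyshev 1 := by
  simp [chebyshev]

theorem X_mul_chebyshev_succ (n : ℕ) :
    Polynomial.X * chebyshev (n + 1) = chebyshev (n + 2) + chebyshev n := by
  rw [chebyshev]; ring

theorem semicircleQuotient_chebyshev (n : ℕ) : ∀ q, semicircleQuotient q (chebyshev n) =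
    ∑ l ∈ Finset.range n, semicircle (q * chebyshev l) * semicircle (chebyshev (n - 1 - l)) := by
  induction n using Nat.twoStepInduction with
  | zero => intro q; simp [chebyshev, semicircleQuotient_one]
  | one =>
    intro q
    rw [← X_mul_chebyshev_zero, semicircleQuotient_X_mul]
    simp [chebyshev, semicircleQuotient_one]
  | more n ih1 ih2 =>
    intro q
    rw [chebyshev, map_sub, semicircleQuotient_X_mul, ih1, ih2, Finset.sum_range_succ',
      Finset.sum_range_succ' _ (n + 1), Finset.sum_range_succ' _ n]
    have e1 : ∀ l, semicircle (q * Polynomial.X * chebyshev (l + 1)) =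
        semicircle (q * chebyshev (l + 2)) + semicircle (q * chebyshev l) := by
      intro l
      rw [mul_assoc, X_mul_chebyshev_succ, mul_add, map_add]
    have e2 : semicircle (q * Polynomial.X * chebyshev 0) = semicircle (q * chebyshev 1) := by
      rw [mul_assoc, X_mul_chebyshev_zero]
    have e3 : ∀ l, n + 1 - 1 - (l + 1) = n - 1 - l := fun l => by omega
    have e4 : ∀ l, n + 2 - 1 - (l + 1 + 1) = n - 1 - l := fun l => by omega
    simp only [e1, e2, e3, e4, add_mul, Finset.sum_add_distrib]
    simp only [zero_add, Nat.sub_zero, Nat.add_sub_cancel, show n + 2 - 1 = n + 1 from rfl]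
    have e5 : chebyshev 0 = 1 := by rw [chebyshev]
    rw [e5, mul_one]
    ring

theorem semicircle_chebyshev (n : ℕ) : semicircle (chebyshev n) = if n = 0 then 1 else 0 := by
  induction n using Nat.strong_induction_on with
  | _ n ih =>
    match n with
    | 0 => simp [chebyshev, semicircle_one]
    | 1 =>
      rw [← X_mul_chebyshev_zero, semicircle_X_mul, chebyshev, semicircleQuotient_one]
      simp
    | n + 2 =>
      rw [chebyshev, map_sub, semicircle_X_mul, semicircleQuotient_chebyshev,
        Finset.sum_range_succ', Finset.sum_eq_zero]
      · simp [chebyshev, semicircle_one]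
      · intro l hl
        have := Finset.mem_range.1 hl
        rw [one_mul, ih (l + 1) (by omega)]
        simp

theorem semicircle_chebyshev_mul (i : ℕ) : ∀ j,
    semicircle (chebyshev i * chebyshev j) = if i = j then 1 else 0 := by
  induction i using Nat.twoStepInduction with
  | zero =>
    intro j
    rw [show chebyshev 0 = 1 by rw [chebyshev], one_mul, semicircle_chebyshev]
    simp only [eq_comm]
  | one =>
    intro j
    rw [show chebyshev 1 = Polynomial.X by rw [chebyshev]]
    cases j with
    | zero => simp [X_mul_chebyshev_zero, semicircle_chebyshev]
    | succ j =>
      rw [X_mul_chebyshev_succ, map_add, semicircle_chebyshev, semicircle_chebyshev]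
      simp [eq_comm]
  | more i ih1 ih2 =>
    intro j
    have e : chebyshev (i + 2) * chebyshev j =
        chebyshev (i + 1) * (Polynomial.X * chebyshev j) - chebyshev i * chebyshev j := by
      rw [chebyshev]; ring
    rw [e, map_sub, ih1]
    cases j with
    | zero => simp [X_mul_chebyshev_zero, ih2]
    | succ j =>
      rw [X_mul_chebyshev_succ, mul_add, map_add, ih2, ih2]
      simp

theorem semicircle_chebyshev_mul_X_mul (i j : ℕ) :
    semicircle (chebyshev i * (Polynomial.X * chebyshev j)) =
      (if i = j + 1 then 1 else 0) + (if i + 1 = j then 1 else 0) := by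
  cases j with
  | zero => rw [X_mul_chebyshev_zero, semicircle_chebyshev_mul]; simp
  | succ j =>
    rw [X_mul_chebyshev_succ, mul_add, map_add, semicircle_chebyshev_mul, semicircle_chebyshev_mul]
    simp

/-- The truncation of the generating function of the Chebyshev polynomials. -/
noncomputable def chebyshevGen (γ : ℝ) (K : ℕ) : Polynomial ℝ :=
  ∑ j ∈ Finset.range (K + 1), γ ^ j • chebyshev j

theorem semicircle_chebyshevGen (γ : ℝ) (K : ℕ) : semicircle (chebyshevGen γ K) = 1 := by
  simp [chebyshevGen, semicircle_chebyshev]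

theorem semicircle_chebyshevGen_mul_self (γ : ℝ) (K : ℕ) :
    semicircle (chebyshevGen γ K * chebyshevGen γ K) =
      ∑ j ∈ Finset.range (K + 1), (γ ^ 2) ^ j := by
  simp only [chebyshevGen, Finset.sum_mul_sum, map_sum, smul_mul_assoc, mul_smul_comm, map_smul,
    semicircle_chebyshev_mul, smul_eq_mul, mul_ite, mul_one, mul_zero]
  refine Finset.sum_congr rfl fun i hi => ?_
  rw [Finset.sum_ite_eq, if_pos hi]
  ring

theorem semicircle_X_mul_chebyshevGen_mul_self (γ : ℝ) (K : ℕ) :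
    semicircle (Polynomial.X * (chebyshevGen γ K * chebyshevGen γ K)) =
      2 * γ * ∑ j ∈ Finset.range K, (γ ^ 2) ^ j := by
  rw [show Polynomial.X * (chebyshevGen γ K * chebyshevGen γ K) =
    chebyshevGen γ K * (Polynomial.X * chebyshevGen γ K) by ring]
  simp only [chebyshevGen, Finset.mul_sum, Finset.sum_mul, map_sum, smul_mul_assoc, mul_smul_comm,
    map_smul, semicircle_chebyshev_mul_X_mul, smul_eq_mul, mul_add, mul_ite, mul_one, mul_zero,
    Finset.sum_add_distrib]
  have h : ∀ j, γ ^ (j + 1) * γ ^ j = γ * (γ ^ 2) ^ j := fun j => by ring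
  have h1 : ∑ j ∈ Finset.range (K + 1), ∑ i ∈ Finset.range (K + 1),
      (if i = j + 1 then γ ^ j * γ ^ i else 0) = ∑ j ∈ Finset.range K, γ * (γ ^ 2) ^ j := by
    rw [Finset.sum_range_succ, Finset.sum_eq_zero (s := Finset.range (K + 1)), add_zero]
    · refine Finset.sum_congr rfl fun j hj => ?_
      rw [Finset.sum_ite_eq', if_pos, mul_comm, h]
      have := Finset.mem_range.1 hj
      exact Finset.mem_range.2 (by omega)
    · intro i hi
      have := Finset.mem_range.1 hi
      rw [if_neg (by omega)]
  have h2 : ∑ j ∈ Finset.range (K + 1), ∑ i ∈ Finset.range (K + 1),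
      (if i + 1 = j then γ ^ j * γ ^ i else 0) = ∑ j ∈ Finset.range K, γ * (γ ^ 2) ^ j := by
    rw [← h1, Finset.sum_comm]
    refine Finset.sum_congr rfl fun i _ => Finset.sum_congr rfl fun j _ => ?_
    rw [mul_comm (γ ^ j)]
    simp only [eq_comm]
  rw [h1, h2, ← Finset.sum_add_distrib]
  refine Finset.sum_congr rfl fun j _ => ?_
  ring

/-- The limit of the largest eigenvalue of `W + α u uᵀ`. -/
noncomputable def spikedTop (α : ℝ) : ℝ := if α ≤ 1 then 2 else α + 1 / α

/-- The variational problem on polynomials whose supremum is `spikedTop α`: the quotient is the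
limit of the Rayleigh quotient of `W + α u uᵀ` at the vector `p(W) u`. -/
theorem exists_polynomial_spikedTop_lt {α ε : ℝ} (hα : 0 ≤ α) (hε : 0 < ε) :
    ∃ p : Polynomial ℝ, 0 < semicircle (p * p) ∧
      (spikedTop α - ε) * semicircle (p * p) <
        semicircle (Polynomial.X * (p * p)) + α * semicircle p ^ 2 := by
  unfold spikedTop
  split_ifs with h
  · obtain ⟨K, hK⟩ := exists_nat_gt (2 / ε)
    rw [div_lt_iff₀ hε] at hK
    refine ⟨chebyshevGen 1 K, ?_, ?_⟩ <;>
    simp only [semicircle_chebyshevGen, semicircle_chebyshevGen_mul_self,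
      semicircle_X_mul_chebyshevGen_mul_self, one_pow, Finset.sum_const, Finset.card_range,
      nsmul_eq_mul, mul_one, Nat.cast_add, Nat.cast_one]
    · positivity
    · nlinarith
  · rw [not_le] at h
    have hα0 : 0 < α := by linarith
    have hγ : 1 / α < 1 := by rw [div_lt_one hα0]; exact h
    have hγ0 : 0 < 1 / α := by positivity
    set γ := 1 / α with hγdef
    have hαγ : α * γ = 1 := by rw [hγdef]; field_simp
    obtain ⟨K, hK⟩ := exists_pow_lt_of_lt_one hε (y := γ ^ 2) (by nlinarith)
    have hS1 : (1 : ℝ) ≤ ∑ j ∈ Finset.range (K + 1), (γ ^ 2) ^ j := by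
      rw [Finset.sum_range_succ', pow_zero]
      have : 0 ≤ ∑ j ∈ Finset.range K, (γ ^ 2) ^ (j + 1) :=
        Finset.sum_nonneg fun _ _ => by positivity
      linarith
    have hS2 : ∑ j ∈ Finset.range (K + 1), (γ ^ 2) ^ j =
        γ ^ 2 * ∑ j ∈ Finset.range K, (γ ^ 2) ^ j + 1 := by
      rw [Finset.sum_range_succ', pow_zero, Finset.mul_sum]
      simp only [pow_succ' (γ ^ 2)]
    have hS3 := Finset.sum_range_succ (fun j => (γ ^ 2) ^ j) K
    refine ⟨chebyshevGen γ K, ?_, ?_⟩ <;>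
    simp only [semicircle_chebyshevGen, semicircle_chebyshevGen_mul_self,
      semicircle_X_mul_chebyshevGen_mul_self, one_pow, mul_one]
    · linarith
    · set S := ∑ j ∈ Finset.range (K + 1), (γ ^ 2) ^ j
      set S' := ∑ j ∈ Finset.range K, (γ ^ 2) ^ j
      -- `α = α S - γ S'` by `hS2`, so the claim reduces to `γ ^ (2 K + 1) < ε S`.
      have e1 : α = α * S - γ * S' := by
        rw [hS2]; linear_combination (γ * S') * (-hαγ)
      have e2 : γ * (γ ^ 2) ^ K < ε * S := by
        have : γ * (γ ^ 2) ^ K ≤ (γ ^ 2) ^ K := mul_le_of_le_one_left (by positivity) hγ.le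
        nlinarith
      have e3 : γ * S = γ * S' + γ * (γ ^ 2) ^ K := by rw [hS3]; ring
      nlinarith

/-! ### From moments to a lower bound for the largest eigenvalue -/

theorem isSymm_aeval {N : ℕ} {A : Matrix (Fin N) (Fin N) ℝ} (hA : A.IsSymm) (p : Polynomial ℝ) :
    (Polynomial.aeval A p).IsSymm := by
  induction p using Polynomial.induction_on' with
  | add p q hp hq => rw [map_add]; exact hp.add hq
  | monomial k a =>
    rw [Polynomial.aeval_monomial, ← Algebra.smul_def]
    exact (hA.pow k).smul a

theorem mulVec_dotProduct_mulVec {N : ℕ} {A B : Matrix (Fin N) (Fin N) ℝ} (hA : A.IsSymm)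
    (u v : Fin N → ℝ) : A.mulVec u ⬝ᵥ B.mulVec v = u ⬝ᵥ (A * B).mulVec v := by
  rw [Matrix.dotProduct_mulVec, ← Matrix.mulVec_transpose, ← Matrix.mulVec_mulVec,
    Matrix.dotProduct_mulVec u, ← Matrix.mulVec_transpose A, hA.eq, Matrix.mulVec_transpose,
    ← Matrix.dotProduct_mulVec]

theorem tendsto_aeval_quadForm {A : ∀ N, Matrix (Fin N) (Fin N) ℝ} {u : ∀ N, Fin N → ℝ}
    (h : ∀ k, Tendsto (fun N => quadPow (A N) (u N) k) atTop (𝓝 (semicircleMoment k)))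
    (p : Polynomial ℝ) :
    Tendsto (fun N => u N ⬝ᵥ (Polynomial.aeval (A N) p).mulVec (u N)) atTop
      (𝓝 (semicircle p)) := by
  induction p using Polynomial.induction_on' with
  | add p q hp hq =>
    simp only [map_add, Matrix.add_mulVec, dotProduct_add]
    exact hp.add hq
  | monomial k a =>
    rw [← Polynomial.C_mul_X_pow_eq_monomial, Polynomial.C_mul', map_smul, semicircle_X_pow]
    simp only [map_smul, map_pow, Polynomial.aeval_X, Matrix.smul_mulVec, dotProduct_smul]
    exact (h k).const_mul a

/-- If the moments at `u` converge to those of the semicircle distribution, then the quadratic form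
of `A + α u uᵀ` has, for large `N`, Rayleigh quotients above `spikedTop α - ε`. -/
theorem eventually_exists_lt_quadForm {A : ∀ N, Matrix (Fin N) (Fin N) ℝ} {u : ∀ N, Fin N → ℝ}
    (hA : ∀ N, 1 ≤ N → (A N).IsSymm)
    (h : ∀ k, Tendsto (fun N => quadPow (A N) (u N) k) atTop (𝓝 (semicircleMoment k)))
    {α ε : ℝ} (hα : 0 ≤ α) (hε : 0 < ε) :
    ∀ᶠ N in atTop, ∃ x : Fin N → ℝ, 0 < x ⬝ᵥ x ∧
      (spikedTop α - ε) * (x ⬝ᵥ x) < x ⬝ᵥ (A N).mulVec x + α * (u N ⬝ᵥ x) ^ 2 := by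
  obtain ⟨p, hp0, hp⟩ := exists_polynomial_spikedTop_lt hα hε
  have h1 := tendsto_aeval_quadForm h (p * p)
  have h2 := tendsto_aeval_quadForm h (Polynomial.X * (p * p))
  have h3 := tendsto_aeval_quadForm h p
  have h4 := h1.const_mul (spikedTop α - ε)
  have h5 := h2.add ((h3.pow 2).const_mul α)
  filter_upwards [h1.eventually_const_lt hp0, h4.eventually_lt h5 hp, eventually_ge_atTop 1]
    with N e1 e2 hN
  have hs := isSymm_aeval (hA N hN) p
  have f1 : (Polynomial.aeval (A N) p).mulVec (u N) ⬝ᵥ (Polynomial.aeval (A N) p).mulVec (u N) =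
      u N ⬝ᵥ (Polynomial.aeval (A N) (p * p)).mulVec (u N) := by
    rw [mulVec_dotProduct_mulVec hs, map_mul]
  have f2 : (Polynomial.aeval (A N) p).mulVec (u N) ⬝ᵥ
      (A N).mulVec ((Polynomial.aeval (A N) p).mulVec (u N)) =
      u N ⬝ᵥ (Polynomial.aeval (A N) (Polynomial.X * (p * p))).mulVec (u N) := by
    rw [Matrix.mulVec_mulVec, mulVec_dotProduct_mulVec hs,
      show Polynomial.X * (p * p) = p * (Polynomial.X * p) by ring, map_mul, map_mul,
      Polynomial.aeval_X]
  refine ⟨(Polynomial.aeval (A N) p).mulVec (u N), ?_, ?_⟩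
  · rw [f1]; exact e1
  · rw [f1, f2]; exact e2

/-! ### From the largest eigenvalue to the overlap -/

/-- The largest eigenvalue of `W + α u uᵀ` is convex in `α`, with slope the squared overlap `s` of
the top eigenvector with `u`. Upper bounds at `q ≠ α` and a lower bound at `α` therefore determine
the limit of `s`, since `spikedTop` is differentiable. -/
theorem tendsto_overlap_of_bounds {α : ℝ} {s l : ℕ → ℝ} (hs : ∀ N, 0 ≤ s N)
    (hl : ∀ ε > 0, ∀ᶠ N in atTop, spikedTop α - ε ≤ l N)
    (hq : ∀ q : ℚ, 1 < (q : ℝ) → ∀ ε > 0, ∀ᶠ N in atTop,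
      l N + (q - α) * s N ≤ q + 1 / q + ε) :
    Tendsto s atTop (𝓝 (if α ≤ 1 then 0 else 1 - 1 / α ^ 2)) := by
  have hupper : ∀ η > 0, ∀ c : ℝ, ∀ q : ℚ, 1 < (q : ℝ) → α < q →
      q + 1 / q - spikedTop α ≤ (q - α) * c → ∀ᶠ N in atTop, s N ≤ c + η := by
    intro η hη c q hq1 hqα hc
    have hd : 0 < (q : ℝ) - α := sub_pos.2 hqα
    have hε : 0 < (q - α) * η / 2 := by positivity
    filter_upwards [hl _ hε, hq q hq1 _ hε] with N h1 h2
    have : (q - α) * s N ≤ (q - α) * (c + η) := by linarith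
    exact le_of_mul_le_mul_left this hd
  refine tendsto_order.2 ⟨fun a ha => ?_, fun a ha => ?_⟩
  · split_ifs at ha with h
    · exact Eventually.of_forall fun N => ha.trans_le (hs N)
    · rw [not_le] at h
      have hα0 : 0 < α := by linarith
      set η := 1 - 1 / α ^ 2 - a with hη
      have hη0 : 0 < η := by linarith
      obtain ⟨q, hq1, hq2⟩ := exists_rat_btwn
        (show max 1 (α - η / 2) < α from max_lt h (by linarith))
      have hq1' : 1 < (q : ℝ) := (le_max_left _ _).trans_lt hq1
      have hq1'' : α - η / 2 < q := (le_max_right _ _).trans_lt hq1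
      have hd : 0 < α - q := sub_pos.2 hq2
      have hε : 0 < (α - q) * (η / 2) / 4 := by positivity
      filter_upwards [hl _ hε, hq q hq1' _ hε] with N h1 h2
      rw [spikedTop, if_neg (not_le.2 h)] at h1
      have hq0 : 0 < (q : ℝ) := by linarith
      have e1 : α + 1 / α - (q + 1 / q) = (α - q) * (1 - 1 / (α * q)) := by field_simp; ring
      have e2 : 1 / (α * q) - 1 / α ^ 2 ≤ α - q := by
        have : 1 / (α * q) - 1 / α ^ 2 = (α - q) / (α ^ 2 * q) := by field_simp
        rw [this]
        refine div_le_self hd.le ?_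
        nlinarith [one_le_pow₀ h.le (n := 2)]
      have h3 : (α - q) * (1 - 1 / (α * q) - η / 4) ≤ (α - q) * s N := by nlinarith
      have h4 := le_of_mul_le_mul_left h3 hd
      linarith
  · split_ifs at ha with h
    · obtain ⟨q, hq1, hq2⟩ := exists_rat_btwn (show (1 : ℝ) < 1 + a / 2 by linarith)
      have hq0 : 0 < (q : ℝ) := by linarith
      filter_upwards [hupper (a / 4) (by linarith) (q - 1) q hq1 (h.trans_lt hq1) (by
        rw [spikedTop, if_pos h]
        have e : (q : ℝ) + 1 / q - 2 = (q - 1) * (q - 1) / q := by field_simp; ring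
        rw [e]
        refine (div_le_self (by nlinarith) hq1.le).trans ?_
        nlinarith)] with N hN
      linarith
    · rw [not_le] at h
      have hα0 : 0 < α := by linarith
      set η := a - (1 - 1 / α ^ 2) with hη
      have hη0 : 0 < η := by linarith
      obtain ⟨q, hq1, hq2⟩ := exists_rat_btwn (show α < α + η / 2 by linarith)
      have hq0 : 0 < (q : ℝ) := by linarith
      filter_upwards [hupper (η / 4) (by linarith) (1 - 1 / (α * q)) q (h.trans hq1) hq1 (by
        rw [spikedTop, if_neg (not_le.2 h)]
        have e : (q : ℝ) + 1 / q - (α + 1 / α) = (q - α) * (1 - 1 / (α * q)) := by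
          field_simp; ring
        rw [e])] with N hN
      have e2 : 1 / α ^ 2 - 1 / (α * q) ≤ q - α := by
        have : 1 / α ^ 2 - 1 / (α * q) = (q - α) / (α ^ 2 * q) := by field_simp
        rw [this]
        refine div_le_self (by linarith) ?_
        nlinarith [one_le_pow₀ h.le (n := 2)]
      linarith

/-- The Rayleigh characterisation of the largest eigenvalue. -/
theorem IsTopUnitEigenvector.quadForm_le {N : ℕ} {A : Matrix (Fin N) (Fin N) ℝ} (hA : A.IsSymm)
    {v : EuclideanSpace ℝ (Fin N)} (hv : IsTopUnitEigenvector A v) :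
    (fun i => v i) ⬝ᵥ (fun i => v i) = 1 ∧ ∀ x : Fin N → ℝ,
      x ⬝ᵥ A.mulVec x ≤ ((fun i => v i) ⬝ᵥ A.mulVec fun i => v i) * (x ⬝ᵥ x) := by
  obtain ⟨hnorm, l, hl, hAv⟩ := hv
  have hvv : (fun i => v i) ⬝ᵥ (fun i => v i) = 1 := by
    have := EuclideanSpace.real_norm_sq_eq v
    rw [hnorm] at this
    rw [dotProduct]
    simp only [← sq]
    linarith
  refine ⟨hvv, fun x => ?_⟩
  rw [hAv, dotProduct_smul, hvv, smul_eq_mul, mul_one]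
  have hH : (l • (1 : Matrix (Fin N) (Fin N) ℝ) - A).IsHermitian := by
    rw [Matrix.IsHermitian, Matrix.conjTranspose_eq_transpose_of_trivial, Matrix.transpose_sub,
      Matrix.transpose_smul, Matrix.transpose_one, hA.eq]
  have hpos : (l • (1 : Matrix (Fin N) (Fin N) ℝ) - A).PosSemidef := by
    rw [hH.posSemidef_iff_eigenvalues_nonneg]
    intro i
    have hw := hH.mulVec_eigenvectorBasis i
    have hne : hH.eigenvectorBasis i ≠ 0 := hH.eigenvectorBasis.orthonormal.ne_zero i
    set w := hH.eigenvectorBasis i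
    have hAw : A.mulVec w.ofLp = (l - hH.eigenvalues i) • w.ofLp := by
      rw [Matrix.sub_mulVec, Matrix.smul_mulVec, Matrix.one_mulVec] at hw
      rw [sub_smul, ← hw]
      abel
    have hev : Module.End.HasEigenvalue (Matrix.toLin' A) (l - hH.eigenvalues i) := by
      refine Module.End.hasEigenvalue_of_hasEigenvector (x := w.ofLp)
        (Module.End.hasEigenvector_iff.2 ⟨Module.End.mem_eigenspace_iff.2 ?_, ?_⟩)
      · rw [Matrix.toLin'_apply, hAw]
      · intro h0
        exact hne (by ext j; exact congrFun h0 j)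
    have := hl.2 hev
    simp only [Pi.zero_apply]
    linarith
  have := hpos.dotProduct_mulVec_nonneg x
  rw [star_trivial, Matrix.sub_mulVec, Matrix.smul_mulVec, Matrix.one_mulVec, dotProduct_sub,
    dotProduct_smul, smul_eq_mul] at this
  linarith

/-! ### Almost sure convergence for GOE matrices with an arbitrary joint law -/

section
variable {Ω : Type*} [MeasurableSpace Ω] {P : Measure Ω}

/-- A GOE matrix in the sense of `IsGOE`, rescaled to have spectrum near `[-2, 2]`, is almost surely
`goeMatrix` of a standard Gaussian vector. -/
theorem IsGOE.exists_hasLaw_gaussianPi {N : ℕ} {G : Ω → Matrix (Fin N) (Fin N) ℝ}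
    (hG : IsGOE P G) : ∃ g : Ω → UpperIdx N → ℝ, HasLaw g (gaussianPi (UpperIdx N)) P ∧
      ∀ᵐ ω ∂P, (2 : ℝ) • scaledMatrix (G ω) = goeMatrix (g ω) := by
  set c : UpperIdx N → ℝ := fun p => if p.1.1 = p.1.2 then 1 else √2 with hc
  refine ⟨fun ω p => c p * G ω p.1.1 p.1.2, ?_, ?_⟩
  · refine iIndepFun.hasLaw_pi (fun p => ?_)
      (hG.indep.comp (fun p x => c p * x) fun p => measurable_id.const_mul _)
    by_cases h : p.1.1 = p.1.2
    · simp only [hc, if_pos h, one_mul]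
      rw [← h]
      exact hG.hasLaw_diag p.1.1
    · have h2 := gaussianReal_const_mul (hG.hasLaw_upper p.1.1 p.1.2 (lt_of_le_of_ne p.2 h)) √2
      simp only [hc, if_neg h]
      convert h2 using 2
      · simp
      · ext
        simp
  · filter_upwards [hG.symm] with ω hω
    ext i j
    have hN : (0 : ℝ) < N := by exact_mod_cast i.pos
    have hent : G ω (min i j) (max i j) = G ω i j := by
      rcases le_total i j with h | h
      · rw [min_eq_left h, max_eq_right h]
      · rw [min_eq_right h, max_eq_left h]; exact hω.apply i j
    have hd : min i j = max i j ↔ i = j := by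
      simp only [Fin.ext_iff, Fin.coe_min, Fin.coe_max]; omega
    simp only [Matrix.smul_apply, scaledMatrix, goeMatrix, goeStd, upperIdx, hc, smul_eq_mul, hent,
      hd]
    rw [Real.sqrt_mul zero_le_two]
    have h2 : √(2 : ℝ) * √2 = 2 := Real.mul_self_sqrt zero_le_two
    have h20 : √(2 : ℝ) ≠ 0 := by positivity
    have hN0 : √(N : ℝ) ≠ 0 := by positivity
    split_ifs
    · rw [Real.sqrt_div zero_le_two]
      field_simp
      linear_combination (-G ω i j) * h2
    · rw [Real.sqrt_div zero_le_one, Real.sqrt_one]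
      field_simp
      linear_combination (-G ω i j) * h2

/-- The Borel–Cantelli lemma for events expressed through standard Gaussian vectors. -/
theorem ae_eventually_notMem_of_gaussianPi_le [IsProbabilityMeasure P]
    {g : ∀ N, Ω → UpperIdx N → ℝ}
    (hg : ∀ N, 1 ≤ N → HasLaw (g N) (gaussianPi (UpperIdx N)) P) (E : ∀ N, Set (UpperIdx N → ℝ))
    {b : ℕ → ℝ} (hb : Summable b)
    (hE : ∀ N, 1 ≤ N → gaussianPi (UpperIdx N) (E N) ≤ ENNReal.ofReal (b N)) :
    ∀ᵐ ω ∂P, ∀ᶠ N in atTop, g N ω ∉ E N := by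
  have h : ∑' N, P {ω | 1 ≤ N ∧ g N ω ∈ E N} ≠ ⊤ := by
    refine ne_top_of_le_ne_top hb.tsum_ofReal_ne_top (ENNReal.tsum_le_tsum fun N => ?_)
    by_cases hN : 1 ≤ N
    · refine le_trans ?_ (hE N hN)
      rw [← (hg N hN).map_eq]
      refine le_trans (measure_mono fun ω hω => hω.2)
        (Measure.le_map_apply (hg N hN).aemeasurable _)
    · simp [hN]
  filter_upwards [ae_eventually_notMem h] with ω hω
  filter_upwards [hω, eventually_ge_atTop 1] with N h1 h2 h3
  exact h1 ⟨h2, h3⟩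

theorem sum_onesUnit_sq {N : ℕ} (hN : 1 ≤ N) : ∑ i, onesUnit N i ^ 2 = 1 := by
  have hN' : (0 : ℝ) < N := by exact_mod_cast hN
  simp only [onesUnit, div_pow, one_pow, Real.sq_sqrt hN'.le, Finset.sum_const, Finset.card_univ,
    Fintype.card_fin, nsmul_eq_mul]
  field_simp

theorem quadForm_rankOnePerturbation {N : ℕ} (α : ℝ) (A : Matrix (Fin N) (Fin N) ℝ)
    (x : Fin N → ℝ) : x ⬝ᵥ (rankOnePerturbation α A).mulVec x =
      x ⬝ᵥ A.mulVec x + α * ((fun i => onesUnit N i) ⬝ᵥ x) ^ 2 := by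
  rw [rankOnePerturbation, Matrix.add_mulVec, dotProduct_add, Matrix.smul_mulVec, dotProduct_smul,
    Matrix.vecMulVec_mulVec, dotProduct_smul]
  simp only [smul_eq_mul, MulOpposite.smul_eq_mul_unop, MulOpposite.unop_op]
  rw [dotProduct_comm x fun i => onesUnit N i]
  ring

theorem isSymm_rankOnePerturbation {N : ℕ} (α : ℝ) {A : Matrix (Fin N) (Fin N) ℝ}
    (hA : A.IsSymm) : (rankOnePerturbation α A).IsSymm := by
  refine Matrix.IsSymm.ext fun i j => ?_
  simp only [rankOnePerturbation, Matrix.add_apply, Matrix.smul_apply, Matrix.vecMulVec_apply,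
    hA.apply i j, mul_comm]

theorem sum_sum_eq_quadForm {N : ℕ} (A : Matrix (Fin N) (Fin N) ℝ) (x : Fin N → ℝ) :
    ∑ i, ∑ j, x i * x j * A i j = x ⬝ᵥ A.mulVec x := by
  simp only [dotProduct, Matrix.mulVec, Finset.mul_sum]
  refine Finset.sum_congr rfl fun i _ => Finset.sum_congr rfl fun j _ => ?_
  ring

/-- The overlap of `u` with maximisers of the quadratic form of `W + α u uᵀ`, for `W` a GOE matrix
with spectrum near `[-2, 2]`. -/
theorem ae_tendsto_overlap [IsProbabilityMeasure P] {G : (N : ℕ) → Ω → Matrix (Fin N) (Fin N) ℝ}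
    (hG : ∀ N, 1 ≤ N → IsGOE P (G N)) {α : ℝ} (hα : 0 ≤ α) :
    ∀ᵐ ω ∂P, ∀ v : (N : ℕ) → Fin N → ℝ,
      (∀ N, 1 ≤ N → v N ⬝ᵥ v N = 1 ∧ ∀ x : Fin N → ℝ,
        x ⬝ᵥ (rankOnePerturbation α ((2 : ℝ) • scaledMatrix (G N ω))).mulVec x ≤
          (v N ⬝ᵥ (rankOnePerturbation α ((2 : ℝ) • scaledMatrix (G N ω))).mulVec (v N)) *
            (x ⬝ᵥ x)) →
      Tendsto (fun N => ((fun i => onesUnit N i) ⬝ᵥ v N) ^ 2) atTop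
        (𝓝 (if α ≤ 1 then 0 else 1 - 1 / α ^ 2)) := by
  have hex : ∀ N, ∃ g : Ω → UpperIdx N → ℝ, 1 ≤ N → HasLaw g (gaussianPi (UpperIdx N)) P ∧
      ∀ᵐ ω ∂P, (2 : ℝ) • scaledMatrix (G N ω) = goeMatrix (g ω) := by
    intro N
    by_cases hN : 1 ≤ N
    · obtain ⟨g, hg⟩ := (hG N hN).exists_hasLaw_gaussianPi
      exact ⟨g, fun _ => hg⟩
    · exact ⟨fun _ _ => 0, fun h => absurd h hN⟩
  choose g hg using hex
  have hglaw := fun N hN => (hg N hN).1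
  have hgeq : ∀ᵐ ω ∂P, ∀ N, 1 ≤ N → (2 : ℝ) • scaledMatrix (G N ω) = goeMatrix (g N ω) :=
    ae_all_iff.2 fun N => by
      by_cases hN : 1 ≤ N
      · filter_upwards [(hg N hN).2] with ω hω _ using hω
      · exact ae_of_all _ fun ω h => absurd h hN
  have hu : ∀ N, 1 ≤ N → ∑ i, onesUnit N i ^ 2 = 1 := fun N hN => sum_onesUnit_sq hN
  have hM : ∀ᵐ ω ∂P, ∀ k m : ℕ, ∀ᶠ N in atTop,
      |quadPow (goeMatrix (g N ω)) (fun i => onesUnit N i) k - semicircleMoment k| <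
        1 / ((m : ℝ) + 1) := by
    refine ae_all_iff.2 fun k => ae_all_iff.2 fun m => ?_
    obtain ⟨b, hb, hbE⟩ := exists_goe_quadPow_deviation_le (u := fun N i => onesUnit N i) hu k
      (ε := 1 / ((m : ℝ) + 1)) (by positivity)
    filter_upwards [ae_eventually_notMem_of_gaussianPi_le hglaw _ hb hbE] with ω hω
    filter_upwards [hω] with N hN
    exact lt_of_not_ge fun h => hN h
  have hU : ∀ᵐ ω ∂P, ∀ (q : ℚ) (m : ℕ), 1 < (q : ℝ) → ∀ᶠ N in atTop, ∀ x : Fin N → ℝ,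
      x ⬝ᵥ x = 1 → x ⬝ᵥ (goeMatrix (g N ω)).mulVec x +
        q * ((fun i => onesUnit N i) ⬝ᵥ x) ^ 2 ≤ q + 1 / q + 1 / ((m : ℝ) + 1) := by
    refine ae_all_iff.2 fun q => ae_all_iff.2 fun m => ?_
    by_cases hq : 1 < (q : ℝ)
    · obtain ⟨b, hb, hbE⟩ := exists_summable_goe_upper_bound (β := q) (ε := 1 / ((m : ℝ) + 1))
        (by linarith) (by positivity)
      filter_upwards [ae_eventually_notMem_of_gaussianPi_le hglaw _ hb
        fun N hN => hbE N hN (fun i => onesUnit N i) (hu N hN)] with ω hω _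
      filter_upwards [hω] with N hN x hx
      refine le_of_not_gt fun h => hN ⟨x, hx, ?_⟩
      rw [sum_sum_eq_quadForm]
      exact h
    · exact ae_of_all _ fun ω h => absurd h hq
  filter_upwards [hgeq, hM, hU] with ω hω hMω hUω v hv
  have hW : ∀ N, (goeMatrix (g N ω)).IsSymm := fun N =>
    Matrix.IsSymm.ext fun i j => by rw [goeMatrix, goeMatrix, goeStd_comm, upperIdx_comm]
  refine tendsto_overlap_of_bounds (l := fun N => v N ⬝ᵥ (goeMatrix (g N ω)).mulVec (v N) +
    α * ((fun i => onesUnit N i) ⬝ᵥ v N) ^ 2) (fun N => sq_nonneg _) ?_ ?_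
  · intro ε hε
    have hmom : ∀ k, Tendsto (fun N => quadPow (goeMatrix (g N ω)) (fun i => onesUnit N i) k) atTop
        (𝓝 (semicircleMoment k)) := by
      intro k
      refine Metric.tendsto_atTop'.2 fun δ hδ => ?_
      obtain ⟨m, hm⟩ := exists_nat_one_div_lt hδ
      obtain ⟨n, hn⟩ := eventually_atTop.1 (hMω k m)
      exact ⟨n, fun N hN => (hn N (le_of_lt hN)).trans hm⟩
    filter_upwards [eventually_exists_lt_quadForm (fun N _ => hW N) hmom hα hε,
      eventually_ge_atTop 1] with N ⟨x, hx0, hx⟩ hN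
    have h := (hv N hN).2 x
    rw [hω N hN, quadForm_rankOnePerturbation, quadForm_rankOnePerturbation] at h
    exact le_of_mul_le_mul_right (hx.le.trans h) hx0
  · intro q hq ε hε
    obtain ⟨m, hm⟩ := exists_nat_one_div_lt hε
    filter_upwards [hUω q m hq, eventually_ge_atTop 1] with N h hN
    have := h (v N) (hv N hN).1
    linarith

end

theorem inner_onesUnit {N : ℕ} (v : EuclideanSpace ℝ (Fin N)) :
    inner ℝ (onesUnit N) v = (fun i => onesUnit N i) ⬝ᵥ fun i => v i := by
  rw [PiLp.inner_apply, dotProduct]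
  refine Finset.sum_congr rfl fun i _ => ?_
  simp [mul_comm]

theorem proposition2p13 {Ω : Type*} [MeasurableSpace Ω] (P : Measure Ω) [IsProbabilityMeasure P]
    (G : (N : ℕ) → Ω → Matrix (Fin N) (Fin N) ℝ) (hG : ∀ N, 1 ≤ N → IsGOE P (G N))
    (α : ℝ) (hα : 0 ≤ α) :
    -- scaled GOE with limiting spectrum `[-1, 1]`
    (∀ᵐ ω ∂P, ∀ v : (N : ℕ) → EuclideanSpace ℝ (Fin N),
      (∀ N, 1 ≤ N →
        IsTopUnitEigenvector (rankOnePerturbation α (scaledMatrix (G N ω))) (v N)) →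
      Tendsto (fun N => (inner ℝ (onesUnit N) (v N)) ^ 2) atTop
        (𝓝 (if α ≤ 1 / 2 then 0 else 1 - 1 / (4 * α ^ 2)))) ∧
    -- scaled GOE with limiting spectrum `[-2, 2]`
    (∀ᵐ ω ∂P, ∀ v : (N : ℕ) → EuclideanSpace ℝ (Fin N),
      (∀ N, 1 ≤ N →
        IsTopUnitEigenvector (rankOnePerturbation α ((2 : ℝ) • scaledMatrix (G N ω))) (v N)) →
      Tendsto (fun N => (inner ℝ (onesUnit N) (v N)) ^ 2) atTop
        (𝓝 (if α ≤ 1 then 0 else 1 - 1 / α ^ 2))) := by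
  have hsymm : ∀ᵐ ω ∂P, ∀ N, 1 ≤ N → (scaledMatrix (G N ω)).IsSymm :=
    ae_all_iff.2 fun N => by
      by_cases hN : 1 ≤ N
      · filter_upwards [(hG N hN).symm] with ω hω _ using hω.smul _
      · exact ae_of_all _ fun ω h => absurd h hN
  constructor
  · -- The matrix of the first part is half of the one of the second part at `2 * α`.
    filter_upwards [hsymm, ae_tendsto_overlap hG (α := 2 * α) (by linarith)] with ω hω h v hv
    simp only [inner_onesUnit]
    have e : (if α ≤ 1 / 2 then (0 : ℝ) else 1 - 1 / (4 * α ^ 2)) =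
        if 2 * α ≤ 1 then 0 else 1 - 1 / (2 * α) ^ 2 := by
      refine if_congr ⟨fun h => by linarith, fun h => by linarith⟩ rfl ?_
      rw [show (2 * α) ^ 2 = 4 * α ^ 2 by ring]
    rw [e]
    refine h (fun N i => v N i) fun N hN => ?_
    have hq := (hv N hN).quadForm_le (isSymm_rankOnePerturbation α (hω N hN))
    refine ⟨hq.1, fun x => ?_⟩
    have := hq.2 x
    rw [quadForm_rankOnePerturbation, quadForm_rankOnePerturbation] at this ⊢
    simp only [Matrix.smul_mulVec, dotProduct_smul, smul_eq_mul]
    linarith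
  · filter_upwards [hsymm, ae_tendsto_overlap hG hα] with ω hω h v hv
    simp only [inner_onesUnit]
    exact h (fun N i => v N i) fun N hN =>
      (hv N hN).quadForm_le (isSymm_rankOnePerturbation α ((hω N hN).smul 2))
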